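/- A \emph{complexon} is a function $W:\bigsqcup_{d\ge 1}[0,1]^{d+1}\to[0,1]$ whose restriction to each $[0,1]^{d+1}$ is Borel measurable and symmetric in its coordinates; by convention $W=1$ on $[0,1]$ and on the empty tuple. Its faceted complexon is $\widehat W(x_1,\dots,x_{d+1})=\prod_{\sigma\subseteq\{1,\dots,d+1\}}W(x_\sigma)$, where $x_\sigma=(x_i)_{i\in\sigma}$. For a simplicial complex $F$ with node set $\{1,\dots,n\}$ put $t(F,W)=\int_{[0,1]^n}\prod_{\sigma\in F}W(x_\sigma)\,dx$; $F$ is said to be of dimension $d$ if it has no simplex with more than $d+1$ nodes. For $j\ge1$ let $$d_{\square,j}(W_1,W_2)=\sup_{S_1,\dots,S_{j+1}\subseteq[0,1]\text{ Borel}}\left|\int_{S_1\times\cdots\times S_{j+1}}(W_1-W_2)\,dx\right|,$$ and for a finite nonnegative sequence $(\alpha_j)=(\alpha_1,\dots,\alpha_d)$ let $$\delta_\square(W_1,W_2;(\alpha_j))=\inf_\varphi\sum_{j=1}^d\alpha_j\,d_{\square,j}(W_1,W_2^\varphi),$$ where $\varphi$ ranges over the measure-preserving maps $[0,1]\to[0,1]$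 and $W_2^\varphi(x_1,\dots,x_{k})=W_2(\varphi(x_1),\dots,\varphi(x_{k}))$. An equipartition of $[0,1]$ is a partition into finitely many measurable sets of equal measure, and $W$ is a stepfunction on it if, in every dimension, the value of $W$ depends only on which parts the coordinates belong to. \textbf{Proposition.} Let $U,W$ be two complexons. Suppose that for some integer $m\ge1$, $U$ and $W$ are stepfunctions on respective equipartitions $\mathcal P_U,\mathcal P_W$ of $[0,1]$, each with at most $m$ parts. Suppose furthermore that for some integers $d\ge1$, $n\ge2$, for all simplicial complexes $F$ on $n$ nodes of dimension $d$, $$|t(F,U)-t(F,W)|\le 0.999\cdot 2^{-((1+n)^{d+2})}.$$ Then, for all finite nonnegative sequences $\alpha_1,\dots,\alpha_d$, $$\delta_\square(\widehat U,\widehat W;(\alpha_j))\le\frac{\sqrt m\,(4d+5)+4}{\sqrt n}\sum_{j=1}^d\alpha_j.$$ -/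

import Mathlib

open MeasureTheory

noncomputable section

/-- A complexon: a totally symmetric measurable function on the disjoint union of the cubes
`[0,1]^k` with values in `[0,1]`. Here `k` is the number of coordinates, so that the restriction to
`[0,1]^(d+1)` is `toFun (d + 1)`; the only relevant cubes are those with `k ≥ 2`, and the value is
`1` on `[0,1]` and on the empty tuple by convention. -/
structure Complexon where
  toFun : (k : ℕ) → (Fin k → unitInterval) → ℝ
  measurable' : ∀ k, Measurable (toFun k)
  mem_Icc' : ∀ k x, toFun k x ∈ Set.Icc (0 : ℝ) 1
  symm' : ∀ k (π : Equiv.Perm (Fin k)) (x : Fin k → unitInterval), toFun k (x ∘ π) = toFun k x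
  eq_one' : ∀ k ≤ 1, ∀ x, toFun k x = 1

namespace Complexon

instance : CoeFun Complexon (fun _ => (k : ℕ) → (Fin k → unitInterval) → ℝ) := ⟨Complexon.toFun⟩

/-- `W.face σ x = W(x_σ)`: the value of `W` on the coordinates of `x` indexed by `σ`. They are
listed in increasing order, which is immaterial by total symmetry. -/
def face (W : Complexon) {n : ℕ} (σ : Finset (Fin n)) (x : Fin n → unitInterval) : ℝ :=
  W σ.card (fun i => x (σ.orderEmbOfFin rfl i))

theorem face_measurable (W : Complexon) {n : ℕ} (σ : Finset (Fin n)) :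
    Measurable (W.face σ) :=
  (W.measurable' σ.card).comp (measurable_pi_lambda _ fun _ => measurable_pi_apply _)

theorem face_mem_Icc (W : Complexon) {n : ℕ} (σ : Finset (Fin n)) (x : Fin n → unitInterval) :
    W.face σ x ∈ Set.Icc (0 : ℝ) 1 :=
  W.mem_Icc' _ _

theorem face_eq (W : Complexon) {n k : ℕ} (σ : Finset (Fin n)) (f : Fin k → Fin n)
    (hf : Function.Injective f) (hσ : Finset.univ.image f = σ) (x : Fin n → unitInterval) :
    W.face σ x = W k (fun i => x (f i)) := by
  have hk : σ.card = k := by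
    rw [← hσ, Finset.card_image_of_injective _ hf, Finset.card_univ, Fintype.card_fin]
  subst hk
  have hm : ∀ i, ∃ j, σ.orderEmbOfFin rfl j = f i := by
    intro i
    have h1 : f i ∈ (σ : Set (Fin n)) := by
      rw [← hσ]; simp
    rw [← Finset.range_orderEmbOfFin σ rfl] at h1
    exact h1
  choose g hg using hm
  have hgi : Function.Injective g := by
    intro a b h
    apply hf
    rw [← hg a, ← hg b, h]
  have hgb : Function.Bijective g := Finite.injective_iff_bijective.mp hgi
  have := W.symm' σ.card (Equiv.ofBijective g hgb) (fun i => x (σ.orderEmbOfFin rfl i))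
  unfold face
  rw [← this]
  congr 1
  funext i
  simp [hg]

theorem face_perm (W : Complexon) {n : ℕ} (σ : Finset (Fin n)) (π : Equiv.Perm (Fin n))
    (x : Fin n → unitInterval) : W.face σ (x ∘ π) = W.face (σ.map π.toEmbedding) x := by
  rw [W.face_eq (σ.map π.toEmbedding) (fun i => π (σ.orderEmbOfFin rfl i))]
  · rfl
  · exact π.injective.comp (σ.orderEmbOfFin rfl).injective
  · ext a
    have := Finset.range_orderEmbOfFin σ rfl
    rw [Set.ext_iff] at this
    simp only [Set.mem_range, Finset.mem_coe] at this
    simp only [Finset.mem_image, Finset.mem_univ, true_and, Finset.mem_map,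
      Equiv.coe_toEmbedding]
    constructor
    · rintro ⟨i, rfl⟩
      exact ⟨_, (this _).1 ⟨i, rfl⟩, rfl⟩
    · rintro ⟨b, hb, rfl⟩
      obtain ⟨i, rfl⟩ := (this b).2 hb
      exact ⟨i, rfl⟩

/-- The faceted complexon: the product of the values of `W` over all the faces of a tuple. -/
def faceted (W : Complexon) : Complexon where
  toFun k x := ∏ σ : Finset (Fin k), W.face σ x
  measurable' k := Finset.measurable_prod _ fun σ _ => W.face_measurable σ
  mem_Icc' k x := ⟨Finset.prod_nonneg fun σ _ => (W.face_mem_Icc σ x).1,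
    Finset.prod_le_one (fun σ _ => (W.face_mem_Icc σ x).1) fun σ _ => (W.face_mem_Icc σ x).2⟩
  symm' k π x := by
    simp only [face_perm]
    exact Fintype.prod_equiv (Equiv.finsetCongr π) _ _ fun σ => rfl
  eq_one' k hk x := Finset.prod_eq_one fun σ _ =>
    W.eq_one' _ ((Finset.card_le_univ σ).trans (by simpa using hk)) _

/-- The pullback `W^φ(x₁, …, x_k) = W(φ x₁, …, φ x_k)`. -/
def pullback (W : Complexon) (φ : unitInterval → unitInterval) (hφ : Measurable φ) : Complexon where
  toFun k x := W k (φ ∘ x)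
  measurable' k := (W.measurable' k).comp
    (measurable_pi_lambda _ fun i => hφ.comp (measurable_pi_apply i))
  mem_Icc' _ _ := W.mem_Icc' _ _
  symm' k π x := W.symm' k π (φ ∘ x)
  eq_one' k hk _ := W.eq_one' k hk _

open scoped Classical in
/-- The homomorphism density `t(F, W) = ∫ ∏_{σ ∈ F} W(x_σ) dx` of a simplicial complex `F` with
node set `Fin n` in a complexon `W`. -/
def homDensity {n : ℕ} (F : AbstractSimplicialComplex (Fin n)) (W : Complexon) : ℝ :=
  ∫ x : Fin n → unitInterval, ∏ σ ∈ Finset.univ.filter (fun σ : Finset (Fin n) => σ ∈ F), W.face σ x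

/-- The `d`-dimensional labeled cut-distance. -/
def cutDistDim (d : ℕ) (W₁ W₂ : Complexon) : ℝ :=
  ⨆ S : Fin (d + 1) → {s : Set unitInterval // MeasurableSet s},
    |∫ x in Set.univ.pi (fun j => (S j : Set unitInterval)), (W₁ (d + 1) x - W₂ (d + 1) x)|

/-- The labeled cut-distance `∑_{j ≥ 1} α_j d_j(W₁, W₂)` (the entry `α 0` is not used). -/
def labeledCutDist (α : ℕ → ℝ) (W₁ W₂ : Complexon) : ℝ :=
  ∑' j : ℕ, α (j + 1) * cutDistDim (j + 1) W₁ W₂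

/-- The unlabeled cut-distance: the infimum of the labeled cut-distance between `W₁` and `W₂^φ` over
all measure-preserving maps `φ : [0,1] → [0,1]`. -/
def cutDist (α : ℕ → ℝ) (W₁ W₂ : Complexon) : ℝ :=
  ⨅ φ : {φ : unitInterval → unitInterval // MeasurePreserving φ volume volume},
    labeledCutDist α W₁ (W₂.pullback φ.1 φ.2.measurable)

/-- `W` is a stepfunction on the family `P`: its values depend only on which of the sets in the
family the coordinates belong to. -/
def IsStepfunction (W : Complexon) {k : ℕ} (P : Fin k → Set unitInterval) : Prop :=
  ∀ (r : ℕ) (x y : Fin r → unitInterval), (∀ a i, x a ∈ P i ↔ y a ∈ P i) → W r x = W r y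

end Complexon

/-- A partition of `[0,1]` into `k` measurable sets of equal measure. -/
structure IsEquipartition {k : ℕ} (P : Fin k → Set unitInterval) : Prop where
  measurableSet : ∀ i, MeasurableSet (P i)
  disjoint : Pairwise fun i j => Disjoint (P i) (P j)
  cover : ⋃ i, P i = Set.univ
  volume_eq : ∀ i j, volume (P i) = volume (P j)

/-- A simplicial complex is of dimension `d` if it has no simplex of dimension greater than `d`,
i.e. no simplex with more than `d + 1` elements. -/
def IsOfDimension {n : ℕ} (F : AbstractSimplicialComplex (Fin n)) (d : ℕ) : Prop :=
  ∀ σ ∈ F, σ.card ≤ d + 1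

end

/-! A stepfunction `U` defines a random complex on `n` vertices. The vertices get independent
uniform types (parts), every vertex set tosses a coin that shows heads with probability `U` at its
types, and a set of between 2 and `d + 1` vertices is a simplex if all its faces with at least two
vertices show heads. The probability of containing a given family of simplices is a homomorphism
density. By inclusion-exclusion, close densities force close laws (`sampleExp_transfer`), so some
family of simplices is simultaneously a good sample of `U` and of `W` (`exists_common_sample`).

A sample is good in two respects. The type frequencies are nearly uniform, with error of order
`√(m/n)` by a variance computation (`avg_typeDev_le`). Moreover, the indicators of simplices are
close in cut norm to the faceted complexon at the sampled types, with error of order `d/√n`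
(`exists_majorant_tuples`). The second claim is delicate because different tuples share faces, so
their indicators are dependent. The indicator of a tuple is therefore telescoped over pairs of
positions `a < b`, grouping the faces by least and greatest position. If only the entries at `a` and
`b` vary, the relevant groups use disjoint sets of coins, and a Bernstein-type exponential moment
bound applies. Only `4 ^ n` pairs of vertex sets need to be controlled, and the variances of the
telescoping terms add up to at most 1 per tuple.

Finally, the sampled indices serve as an intermediary: maximal couplings of indices with the parts
of `U` and of `W` are glued and realised by a measure-preserving map (`exists_aligning_map`). If
`√n` is too small for these estimates, the claimed bound is trivial because each cut distance is at
most 1. -/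

/-! ### Independent coin tosses. -/

/-- The expectation of `f ω`, where the coins `ω a` are independent and `ω a` is `true` with
probability `p a`. -/
noncomputable def coinExp {κ : Type*} [Fintype κ] [DecidableEq κ] (p : κ → ℝ)
    (f : (κ → Bool) → ℝ) : ℝ :=
  ∑ ω : κ → Bool, (∏ a, if ω a then p a else 1 - p a) * f ω

/-- `f` does not depend on the coordinates in `C`. -/
def Insensitive {κ : Type*} (C : Finset κ) (f : (κ → Bool) → ℝ) : Prop :=
  ∀ ω ω' : κ → Bool, (∀ a, a ∉ C → ω a = ω' a) → f ω = f ω'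

/-- The indicator of the event that all the coins in `C` are `true`. -/
def allHeads {κ : Type*} (C : Finset κ) (ω : κ → Bool) : ℝ := ∏ a ∈ C, if ω a then 1 else 0

theorem Insensitive.mono {κ : Type*} {C C' : Finset κ} {f : (κ → Bool) → ℝ} (h : Insensitive C f)
    (hC : C' ⊆ C) : Insensitive C' f :=
  fun ω ω' hω => h ω ω' fun a ha => hω a fun h' => ha (hC h')

theorem Insensitive.mul {κ : Type*} {C : Finset κ} {f g : (κ → Bool) → ℝ} (hf : Insensitive C f)
    (hg : Insensitive C g) : Insensitive C fun ω => f ω * g ω :=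
  fun ω ω' h => by simp only [hf ω ω' h, hg ω ω' h]

theorem Insensitive.const {κ : Type*} (C : Finset κ) (c : ℝ) : Insensitive C fun _ => c :=
  fun _ _ _ => rfl

theorem Insensitive.prod {κ ι : Type*} {C : Finset κ} (s : Finset ι) {f : ι → (κ → Bool) → ℝ}
    (hf : ∀ i ∈ s, Insensitive C (f i)) : Insensitive C fun ω => ∏ i ∈ s, f i ω :=
  fun ω ω' h => Finset.prod_congr rfl fun i hi => hf i hi ω ω' h

theorem insensitive_allHeads {κ : Type*} {C C' : Finset κ} (h : Disjoint C C') :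
    Insensitive C (allHeads C') := fun ω ω' hω =>
  Finset.prod_congr rfl fun a ha => by rw [hω a (Finset.disjoint_right.1 h ha)]

theorem allHeads_eq_ite {κ : Type*} (C : Finset κ) (ω : κ → Bool) :
    allHeads C ω = if ∀ a ∈ C, ω a = true then 1 else 0 := by
  unfold allHeads
  rw [Finset.prod_ite_zero]
  simp

theorem allHeads_mem_Icc {κ : Type*} (C : Finset κ) (ω : κ → Bool) : allHeads C ω ∈ Set.Icc (0 : ℝ) 1 := by
  rw [allHeads_eq_ite]; split_ifs <;> simp

theorem coinWeight_nonneg {κ : Type*} [Fintype κ] {p : κ → ℝ}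
    (hp : ∀ a, p a ∈ Set.Icc (0 : ℝ) 1) (ω : κ → Bool) :
    0 ≤ ∏ a, if ω a then p a else 1 - p a :=
  Finset.prod_nonneg fun a _ => by
    have := hp a
    split_ifs <;> [exact this.1; linarith [this.2]]

section Coins

variable {κ : Type*} [Fintype κ] [DecidableEq κ] {p : κ → ℝ}

theorem coinExp_mono (hp : ∀ a, p a ∈ Set.Icc (0 : ℝ) 1) {f g : (κ → Bool) → ℝ}
    (h : ∀ ω, f ω ≤ g ω) : coinExp p f ≤ coinExp p g :=
  Finset.sum_le_sum fun ω _ => mul_le_mul_of_nonneg_left (h ω) (coinWeight_nonneg hp ω)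

theorem coinExp_add (f g : (κ → Bool) → ℝ) :
    coinExp p (fun ω => f ω + g ω) = coinExp p f + coinExp p g := by
  simp only [coinExp, mul_add, Finset.sum_add_distrib]

theorem coinExp_const_mul (c : ℝ) (f : (κ → Bool) → ℝ) :
    coinExp p (fun ω => c * f ω) = c * coinExp p f := by
  simp only [coinExp, Finset.mul_sum]
  exact Finset.sum_congr rfl fun _ _ => by ring

theorem coinExp_sum {ι : Type*} (s : Finset ι) (f : ι → (κ → Bool) → ℝ) :
    coinExp p (fun ω => ∑ i ∈ s, f i ω) = ∑ i ∈ s, coinExp p (f i) := by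
  simp only [coinExp, Finset.mul_sum]
  exact Finset.sum_comm

theorem coinExp_one : coinExp p (fun _ => 1) = 1 := by
  have := Finset.prod_univ_sum (fun _ : κ => (Finset.univ : Finset Bool))
    (fun a b => if b then p a else 1 - p a)
  simp only [Fintype.piFinset_univ] at this
  simp only [coinExp, mul_one]
  rw [← this]
  simp

theorem coinExp_const (c : ℝ) : coinExp p (fun _ => c) = c := by
  have := coinExp_const_mul (p := p) c fun _ => 1
  simpa [coinExp_one] using this

theorem coinExp_coord (a : κ) (G : (κ → Bool) → ℝ) (hG : Insensitive {a} G) :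
    coinExp p (fun ω => (if ω a then 1 else 0) * G ω) = p a * coinExp p G := by
  rw [← sub_eq_zero, ← coinExp_const_mul]
  simp only [coinExp, ← Finset.sum_sub_distrib]
  -- Flipping the coin `a` pairs off the outcomes: up to a common factor their contributions are `p
  -- (1 - p)` and `(1 - p) (0 - p)`, which cancel.
  refine Finset.sum_involution (fun ω _ => Function.update ω a (!ω a)) ?_ ?_ (by simp) ?_
  · intro ω _
    have hG' : G (Function.update ω a (!ω a)) = G ω :=
      hG _ _ fun b hb => Function.update_of_ne (by simpa using hb) _ _
    rw [hG', ← Finset.mul_prod_erase _ _ (Finset.mem_univ a),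
      ← Finset.mul_prod_erase _ (fun b => if Function.update ω a (!ω a) b then p b else 1 - p b)
        (Finset.mem_univ a)]
    have : ∏ x ∈ Finset.univ.erase a, (if Function.update ω a (!ω a) x then p x else 1 - p x)
        = ∏ x ∈ Finset.univ.erase a, (if ω x then p x else 1 - p x) :=
      Finset.prod_congr rfl fun b hb => by rw [Function.update_of_ne (Finset.ne_of_mem_erase hb)]
    rw [this]
    cases ω a <;> simp <;> ring
  · intro ω _ _ h
    have := congrFun h a
    simp at this
  · intro ω _
    simp

theorem coinExp_allHeads_mul (C : Finset κ) (G : (κ → Bool) → ℝ) (hG : Insensitive C G) :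
    coinExp p (fun ω => allHeads C ω * G ω) = (∏ a ∈ C, p a) * coinExp p G := by
  induction C using Finset.induction_on with
  | empty => simp [allHeads]
  | insert a C ha ih =>
    rw [Finset.prod_insert ha, mul_assoc, ← ih (hG.mono (Finset.subset_insert _ _)),
      ← coinExp_coord a]
    · simp only [allHeads, Finset.prod_insert ha, mul_assoc]
    · exact (insensitive_allHeads (by simpa using ha)).mul (hG.mono (by simp))

theorem coinExp_allHeads (C : Finset κ) : coinExp p (allHeads C) = ∏ a ∈ C, p a := by
  have := coinExp_allHeads_mul (p := p) C (fun _ => 1) (Insensitive.const _ _)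
  simpa [coinExp_one] using this

end Coins

/-! ### Exponential moments and a maximal inequality. -/

/-- The cubic Taylor remainder is at most `2/9 |y|³ ≤ 4/45 y²`, which is less than `y²/10`. -/
theorem exp_le_one_add_sq {y : ℝ} (hy : |y| ≤ 2 / 5) : Real.exp y ≤ 1 + y + 3 / 5 * y ^ 2 := by
  have h := Real.exp_bound (x := y) (by linarith) (n := 3) (by norm_num)
  have h1 := (abs_le.1 h).2
  simp [Finset.sum_range_succ, Nat.factorial] at h1
  have h2 : |y| ^ 3 ≤ 2 / 5 * y ^ 2 := by
    rw [pow_succ, sq_abs, mul_comm]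
    exact mul_le_mul_of_nonneg_right hy (sq_nonneg _)
  nlinarith [sq_nonneg y]

/-- This bounds the moment generating function of a centred Bernoulli variable. The variance `q (1 -
q)` is kept, rather than bounded by 1/4 as in Hoeffding's lemma, because the variances of the
telescoping terms have to be summed later. -/
theorem two_point_exp_le {q θ : ℝ} (hq : q ∈ Set.Icc (0 : ℝ) 1) (hθ : |θ| ≤ 2 / 5) :
    (1 - q) * Real.exp (-(θ * q)) + q * Real.exp (θ * (1 - q))
      ≤ Real.exp (3 / 5 * (θ ^ 2 * (q * (1 - q)))) := by
  obtain ⟨h0, h1⟩ := hq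
  have a1 : |-(θ * q)| ≤ 2 / 5 := by
    rw [abs_neg, abs_mul, abs_of_nonneg h0]
    nlinarith [abs_nonneg θ]
  have a2 : |θ * (1 - q)| ≤ 2 / 5 := by
    rw [abs_mul, abs_of_nonneg (sub_nonneg.2 h1)]
    nlinarith [abs_nonneg θ]
  have e1 := mul_le_mul_of_nonneg_left (exp_le_one_add_sq a1) (sub_nonneg.2 h1)
  have e2 := mul_le_mul_of_nonneg_left (exp_le_one_add_sq a2) h0
  have e3 := Real.add_one_le_exp (3 / 5 * (θ ^ 2 * (q * (1 - q))))
  have : (1 - q) * (1 + -(θ * q) + 3 / 5 * (-(θ * q)) ^ 2)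
      + q * (1 + θ * (1 - q) + 3 / 5 * (θ * (1 - q)) ^ 2)
      = 3 / 5 * (θ ^ 2 * (q * (1 - q))) + 1 := by ring
  linarith

/-- A bound on the exponential moments of a sum of terms `θ_i (η_i - E η_i)`, where the `η_i` are
indicators of events that concern disjoint sets of coins, on which the coefficients `θ_j` do not
depend. -/
theorem coinExp_prod_exp_le {κ ι : Type*} [Fintype κ] [DecidableEq κ] [DecidableEq ι] {p : κ → ℝ}
    (hp : ∀ a, p a ∈ Set.Icc (0 : ℝ) 1) (D : Finset ι) (C : ι → Finset κ)
    (θ : ι → (κ → Bool) → ℝ) (v : ι → ℝ)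
    (hC : ∀ i ∈ D, ∀ j ∈ D, i ≠ j → Disjoint (C i) (C j))
    (hθC : ∀ i ∈ D, ∀ j ∈ D, Insensitive (C i) (θ j))
    (hθ : ∀ i ∈ D, ∀ ω, |θ i ω| ≤ 2 / 5)
    (hv : ∀ i ∈ D, ∀ ω, θ i ω ^ 2 * ((∏ a ∈ C i, p a) * (1 - ∏ a ∈ C i, p a)) ≤ v i) :
    coinExp p (fun ω => ∏ i ∈ D, Real.exp (θ i ω * (allHeads (C i) ω - ∏ a ∈ C i, p a)))
      ≤ ∏ i ∈ D, Real.exp (3 / 5 * v i) := by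
  induction D using Finset.induction_on with
  | empty => simp [coinExp_one]
  | insert i D hi ih =>
    have hD := Finset.subset_insert i D
    have hiD := Finset.mem_insert_self i D
    have ih' := ih (fun i hi j hj => hC i (hD hi) j (hD hj))
      (fun i hi j hj => hθC i (hD hi) j (hD hj)) (fun i hi => hθ i (hD hi))
      fun i hi => hv i (hD hi)
    set q := ∏ a ∈ C i, p a with hq
    set G : (κ → Bool) → ℝ := fun ω =>
      ∏ i ∈ D, Real.exp (θ i ω * (allHeads (C i) ω - ∏ a ∈ C i, p a)) with hGdef
    have hq01 : q ∈ Set.Icc (0 : ℝ) 1 :=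
      ⟨Finset.prod_nonneg fun a _ => (hp a).1,
        Finset.prod_le_one (fun a _ => (hp a).1) fun a _ => (hp a).2⟩
    have hG0 : ∀ ω, 0 ≤ G ω := fun ω => Finset.prod_nonneg fun _ _ => (Real.exp_pos _).le
    have hGi : Insensitive (C i) G := Insensitive.prod _ fun j hj ω ω' h => by
      simp only [hθC i hiD j (hD hj) ω ω' h,
        insensitive_allHeads (hC i hiD j (hD hj) (by rintro rfl; exact hi hj)) ω ω' h]
    have hθi : ∀ c : ℝ, Insensitive (C i) fun ω => Real.exp (θ i ω * c) := fun c ω ω' h => by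
      simp only [hθC i hiD i hiD ω ω' h]
    simp only [Finset.prod_insert hi]
    -- The indicator takes only the values 0 and 1, so the exponential is affine in it; independence
    -- then allows averaging over the coins in `C i` alone.
    have key : ∀ ω, Real.exp (θ i ω * (allHeads (C i) ω - q)) * G ω
        = Real.exp (θ i ω * (-q)) * G ω
          + allHeads (C i) ω * ((Real.exp (θ i ω * (1 - q)) - Real.exp (θ i ω * (-q))) * G ω) := by
      intro ω
      rw [allHeads_eq_ite]
      split_ifs
      · ring
      · simp
    have e1 : coinExp p (fun ω => Real.exp (θ i ω * (allHeads (C i) ω - q)) * G ω)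
        = coinExp p fun ω => ((1 - q) * Real.exp (-(θ i ω * q))
            + q * Real.exp (θ i ω * (1 - q))) * G ω := by
      simp only [key]
      rw [coinExp_add, coinExp_allHeads_mul, ← hq, ← coinExp_const_mul, ← coinExp_add]
      · congr 1
        funext ω
        rw [mul_neg]
        ring
      · refine Insensitive.mul (fun ω ω' h => ?_) hGi
        simp only [hθC i hiD i hiD ω ω' h]
    rw [e1]
    calc _ ≤ coinExp p fun ω => Real.exp (3 / 5 * v i) * G ω := coinExp_mono hp fun ω =>
          mul_le_mul_of_nonneg_right ((two_point_exp_le hq01 (hθ i hiD ω)).trans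
            (Real.exp_le_exp.2 (by linarith [hv i hiD ω]))) (hG0 ω)
      _ = Real.exp (3 / 5 * v i) * coinExp p G := coinExp_const_mul _ _
      _ ≤ _ := mul_le_mul_of_nonneg_left ih' (Real.exp_pos _).le

/-- A linear form on the cube is extremal at a vertex: keep the coordinates whose coefficients have
the sign of the sum. -/
theorem exists_subset_abs_sum_le {ι : Type*} [Fintype ι] (L f : ι → ℝ)
    (hf : ∀ u, f u ∈ Set.Icc (0 : ℝ) 1) :
    ∃ S : Finset ι, |∑ u, f u * L u| ≤ |∑ u ∈ S, L u| := by
  classical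
  rcases le_total 0 (∑ u, f u * L u) with h | h
  · refine ⟨Finset.univ.filter fun u => 0 ≤ L u, ?_⟩
    rw [abs_of_nonneg h, abs_of_nonneg (Finset.sum_nonneg fun u hu => (Finset.mem_filter.1 hu).2),
      Finset.sum_filter]
    refine Finset.sum_le_sum fun u _ => ?_
    split_ifs with hu
    · exact mul_le_of_le_one_left hu (hf u).2
    · exact mul_nonpos_of_nonneg_of_nonpos (hf u).1 (not_le.1 hu).le
  · refine ⟨Finset.univ.filter fun u => L u ≤ 0, ?_⟩
    rw [abs_of_nonpos h, abs_of_nonpos (Finset.sum_nonpos fun u hu => (Finset.mem_filter.1 hu).2),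
      Finset.sum_filter]
    refine neg_le_neg (Finset.sum_le_sum fun u _ => ?_)
    split_ifs with hu
    · nlinarith [(hf u).2]
    · exact mul_nonneg (hf u).1 (not_le.1 hu).le

/-- The absolute value of a bilinear form on vectors with entries in `[0,1]` is largest at a pair
of indicator vectors. -/
theorem exists_subset_abs_bilin_le {ι κ : Type*} [Fintype ι] [Fintype κ] (x : ι → κ → ℝ)
    (f : ι → ℝ) (g : κ → ℝ) (hf : ∀ u, f u ∈ Set.Icc (0 : ℝ) 1)
    (hg : ∀ u, g u ∈ Set.Icc (0 : ℝ) 1) :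
    ∃ (S : Finset ι) (T : Finset κ),
      |∑ u, ∑ v, f u * g v * x u v| ≤ |∑ u ∈ S, ∑ v ∈ T, x u v| := by
  obtain ⟨S, hS⟩ := exists_subset_abs_sum_le (fun u => ∑ v, g v * x u v) f hf
  obtain ⟨T, hT⟩ := exists_subset_abs_sum_le (fun v => ∑ u ∈ S, x u v) g hg
  refine ⟨S, T, ?_⟩
  rw [Finset.sum_comm (s := S)]
  refine le_trans (le_trans (le_of_eq ?_) (hS.trans (le_of_eq ?_))) hT
  · simp only [Finset.mul_sum, mul_assoc]
  · rw [Finset.sum_comm]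
    simp only [Finset.mul_sum]

/-- A maximal inequality: finitely many functions with bounded exponential moments have a common
majorant of small expectation. -/
theorem exists_majorant {κ J : Type*} [Fintype κ] [DecidableEq κ] [Fintype J] [Nonempty J]
    {p : κ → ℝ} (X : J → (κ → Bool) → ℝ) {c W : ℝ} (hc : 0 < c)
    (h1 : ∀ j, coinExp p (fun ω => Real.exp (c * X j ω)) ≤ Real.exp W)
    (h2 : ∀ j, coinExp p (fun ω => Real.exp (-c * X j ω)) ≤ Real.exp W) :
    ∃ M : (κ → Bool) → ℝ, (∀ ω j, |X j ω| ≤ M ω) ∧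
      coinExp p M ≤ (Real.log (2 * Fintype.card J) + W) / c := by
  set N : ℝ := 2 * Fintype.card J with hN
  have hN0 : 0 < N := by
    have : 0 < Fintype.card J := Fintype.card_pos
    positivity
  -- The majorant comes from `y + 1 ≤ exp y` at `y = c |X j ω| - W - log N`, with the exponential of
  -- one term bounded by the sum over all `j`. That sum has expectation at most `N * exp W`, which
  -- cancels the `-1`.
  refine ⟨fun ω => c⁻¹ * ((Real.log N - 1 + W) + (N⁻¹ * Real.exp (-W)) *
    ∑ j, (Real.exp (c * X j ω) + Real.exp (-c * X j ω))), fun ω j => ?_, ?_⟩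
  · have hle : Real.exp (c * |X j ω|)
        ≤ ∑ j, (Real.exp (c * X j ω) + Real.exp (-c * X j ω)) := by
      refine le_trans ?_ (Finset.single_le_sum (f := fun j => Real.exp (c * X j ω)
        + Real.exp (-c * X j ω)) (fun i _ => by positivity) (Finset.mem_univ j))
      rcases abs_cases (X j ω) with ⟨h, _⟩ | ⟨h, _⟩ <;> rw [h]
      · linarith [Real.exp_pos (-c * X j ω)]
      · rw [mul_neg, ← neg_mul]
        linarith [Real.exp_pos (c * X j ω)]
    have h3 := Real.add_one_le_exp (c * |X j ω| - W - Real.log N)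
    have h4 : Real.exp (c * |X j ω| - W - Real.log N)
        = N⁻¹ * Real.exp (-W) * Real.exp (c * |X j ω|) := by
      rw [Real.exp_sub, Real.exp_log hN0, sub_eq_add_neg, Real.exp_add]
      field_simp
    have h5 := mul_le_mul_of_nonneg_left hle
      (by positivity : 0 ≤ N⁻¹ * Real.exp (-W))
    beta_reduce
    rw [inv_mul_eq_div c, le_div_iff₀ hc]
    linarith
  · rw [coinExp_const_mul, coinExp_add, coinExp_const, coinExp_const_mul, coinExp_sum,
      inv_mul_eq_div]
    refine div_le_div_of_nonneg_right ?_ hc.le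
    have : ∑ j, coinExp p (fun ω => Real.exp (c * X j ω) + Real.exp (-c * X j ω))
        ≤ N * Real.exp W := by
      calc _ ≤ ∑ j : J, (Real.exp W + Real.exp W) := Finset.sum_le_sum fun j _ => by
            rw [coinExp_add]; exact add_le_add (h1 j) (h2 j)
        _ = _ := by simp [hN]; ring
    have h6 := mul_le_mul_of_nonneg_left this (by positivity : 0 ≤ N⁻¹ * Real.exp (-W))
    have h7 : N⁻¹ * Real.exp (-W) * (N * Real.exp W) = 1 := by
      rw [Real.exp_neg]
      field_simp
    linarith

/-- Exchanging the entry at `a` with `u` is an involution on the pairs `(i, u)`. This expresses that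
resampling a coordinate preserves the uniform distribution. -/
theorem sum_sum_update {ι β : Type*} [Fintype ι] [DecidableEq ι] [Fintype β]
    (F : (ι → β) → ℝ) (a : ι) :
    ∑ i : ι → β, ∑ u, F (Function.update i a u) = Fintype.card β * ∑ i, F i := by
  have hinv : Function.Involutive fun x : (ι → β) × β => (Function.update x.1 a x.2, x.1 a) := by
    rintro ⟨i, u⟩
    simp
  rw [← Fintype.sum_prod_type', Fintype.sum_equiv hinv.toPerm
    (fun x : (ι → β) × β => F (Function.update x.1 a x.2)) (fun x => F x.1) (fun _ => rfl),
    Fintype.sum_prod_type]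
  simp [Finset.mul_sum]

/-! ### Telescoping over the least and greatest positions of faces. -/

/-- The pairs of positions `a < b`, ordered lexicographically. -/
def posPairs (k : ℕ) : Finset (Fin k ×ₗ Fin k) :=
  Finset.univ.filter fun s => (ofLex s).1 < (ofLex s).2

/-- The sets of positions whose least element is `a` and whose greatest element is `b`. -/
def spanning {k : ℕ} (s : Fin k ×ₗ Fin k) : Finset (Finset (Fin k)) :=
  Finset.univ.filter fun B =>
    (ofLex s).1 ∈ B ∧ (ofLex s).2 ∈ B ∧ ∀ c ∈ B, (ofLex s).1 ≤ c ∧ c ≤ (ofLex s).2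

theorem spanning_unique {k : ℕ} {s r : Fin k ×ₗ Fin k} {B : Finset (Fin k)}
    (hs : B ∈ spanning s) (hr : B ∈ spanning r) : s = r := by
  simp only [spanning, Finset.mem_filter, Finset.mem_univ, true_and] at hs hr
  apply ofLex.injective
  refine Prod.ext (le_antisymm ?_ ?_) (le_antisymm ?_ ?_)
  · exact (hs.2.2 _ hr.1).1
  · exact (hr.2.2 _ hs.1).1
  · exact (hr.2.2 _ hs.2.1).2
  · exact (hs.2.2 _ hr.2.1).2

/-- Together with `spanning_unique`, this partitions the faces by their extreme positions. Every
face in the class of `s` contains both positions of `s`, which makes its coin sensitive to both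
varying entries. -/
theorem biUnion_spanning (k : ℕ) :
    (posPairs k).biUnion spanning = Finset.univ.filter fun B : Finset (Fin k) => 2 ≤ B.card := by
  ext B
  simp only [Finset.mem_biUnion, posPairs, spanning, Finset.mem_filter, Finset.mem_univ, true_and]
  constructor
  · rintro ⟨s, hs, ha, hb, -⟩
    exact Finset.one_lt_card.2 ⟨_, ha, _, hb, hs.ne⟩
  · intro hB
    have hne : B.Nonempty := Finset.card_pos.1 (by omega)
    refine ⟨toLex (B.min' hne, B.max' hne), Finset.min'_lt_max'_of_card B hB,
      B.min'_mem hne, B.max'_mem hne, fun c hc => ⟨B.min'_le c hc, B.le_max' c hc⟩⟩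

theorem card_posPairs (k : ℕ) : 2 * ((posPairs k).card : ℝ) = k * (k - 1) := by
  have h1 : (posPairs k).card
      = (Finset.univ.filter fun x : Fin k × Fin k => x.1 < x.2).card :=
    Finset.card_equiv ofLex (by simp [posPairs])
  have h2 : (Finset.univ.filter fun x : Fin k × Fin k => x.1 < x.2).card
      = (Finset.univ.filter fun x : Fin k × Fin k => x.2 < x.1).card :=
    Finset.card_equiv (Equiv.prodComm _ _) (by simp)
  have h3 : (Finset.univ.filter fun x : Fin k × Fin k => x.1 = x.2).card = k := by
    have : (Finset.univ.filter fun x : Fin k × Fin k => x.1 = x.2)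
        = Finset.univ.image fun a => (a, a) := by
      ext ⟨a, b⟩; simp
    rw [this, Finset.card_image_of_injective _ (fun a b h => by simpa using h)]
    simp
  have h4 : k * k = (Finset.univ.filter fun x : Fin k × Fin k => x.1 < x.2).card
      + (Finset.univ.filter fun x : Fin k × Fin k => x.2 < x.1).card
      + (Finset.univ.filter fun x : Fin k × Fin k => x.1 = x.2).card := by
    rw [← Finset.card_union_of_disjoint, ← Finset.card_union_of_disjoint]
    · have : (Finset.univ : Finset (Fin k × Fin k)).card = k * k := by simp
      rw [← this]
      congr 1
      ext x
      rcases lt_trichotomy x.1 x.2 with h | h | h <;> simp [h]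
    · rw [Finset.disjoint_left]
      intro x hx hx'
      simp only [Finset.mem_union, Finset.mem_filter, Finset.mem_univ, true_and] at hx hx'
      rcases hx with h | h <;> simp [hx'] at h
    · rw [Finset.disjoint_left]
      intro x hx hx'
      simp at hx hx'
      exact absurd hx hx'.not_gt
  rw [h3, ← h2, ← h1] at h4
  have : (k : ℝ) * k = (posPairs k).card + (posPairs k).card + k := by exact_mod_cast h4
  linarith

/-- The images under `i` of the sets of positions that span `s`. -/
def spanCoins {n k : ℕ} (i : Fin k → Fin n) (s : Fin k ×ₗ Fin k) : Finset (Finset (Fin n)) :=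
  (spanning s).image fun B => B.image i

/-- The images under `i` of the sets of at least two positions. -/
def allCoins {n k : ℕ} (i : Fin k → Fin n) : Finset (Finset (Fin n)) :=
  (Finset.univ.filter fun B : Finset (Fin k) => 2 ≤ B.card).image fun B => B.image i

theorem prod_allCoins {n k : ℕ} {i : Fin k → Fin n} (hi : Function.Injective i)
    (g : Finset (Fin n) → ℝ) :
    ∏ A ∈ allCoins i, g A = ∏ s ∈ posPairs k, ∏ A ∈ spanCoins i s, g A := by
  have hinj := Finset.image_injective hi
  unfold allCoins spanCoins
  rw [Finset.prod_image hinj.injOn, ← biUnion_spanning, Finset.prod_biUnion]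
  · exact Finset.prod_congr rfl fun s _ => (Finset.prod_image hinj.injOn).symm
  · intro s _ r _ hsr
    rw [Function.onFun, Finset.disjoint_left]
    intro B hs hr
    exact hsr (spanning_unique hs hr)

/-- The product of `p` over the coins that span `s`. -/
def spanProb {n k : ℕ} (p : Finset (Fin n) → ℝ) (i : Fin k → Fin n) (s : Fin k ×ₗ Fin k) : ℝ :=
  ∏ A ∈ spanCoins i s, p A

/-- The term for `s` in the telescoping sum for the difference between the indicator that all the
coins of a tuple are heads and the probability of this event. -/
noncomputable def hybridTerm {n k : ℕ} (p : Finset (Fin n) → ℝ) (s : Fin k ×ₗ Fin k)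
    (i : Fin k → Fin n) (ω : Finset (Fin n) → Bool) : ℝ :=
  (allHeads (spanCoins i s) ω - spanProb p i s) * (∏ r ∈ posPairs k with r < s, spanProb p i r) *
    ∏ r ∈ posPairs k with s < r, allHeads (spanCoins i r) ω

theorem sum_hybridTerm {n k : ℕ} (p : Finset (Fin n) → ℝ) {i : Fin k → Fin n}
    (hi : Function.Injective i) (ω : Finset (Fin n) → Bool) :
    allHeads (allCoins i) ω - ∏ A ∈ allCoins i, p A = ∑ s ∈ posPairs k, hybridTerm p s i ω := by
  have h1 := prod_allCoins hi (fun A => if ω A then (1 : ℝ) else 0)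
  have h2 := prod_allCoins hi p
  -- Replace the indicators by their probabilities one pair at a time: pairs before `s` already
  -- carry probabilities, pairs after `s` still carry indicators.
  have := Finset.prod_sub_ordered (posPairs k) (fun r => allHeads (spanCoins i r) ω)
    (fun r => allHeads (spanCoins i r) ω - spanProb p i r)
  simp only [sub_sub_cancel] at this
  rw [allHeads, h1, h2]
  simp only [allHeads, spanProb, hybridTerm] at this ⊢
  rw [this]
  ring

/-- The tuple `i` with the entries at the positions `a` and `b` replaced by `u` and `v`. -/
def replaceTwo {n k : ℕ} (i : Fin k → Fin n) (s : Fin k ×ₗ Fin k) (x : Fin n × Fin n) :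
    Fin k → Fin n :=
  Function.update (Function.update i (ofLex s).1 x.1) (ofLex s).2 x.2

section Replace

variable {n k : ℕ} (i : Fin k → Fin n) {s : Fin k ×ₗ Fin k} (x : Fin n × Fin n)

theorem replaceTwo_snd : replaceTwo i s x (ofLex s).2 = x.2 := by simp [replaceTwo]

theorem replaceTwo_fst (hs : s ∈ posPairs k) : replaceTwo i s x (ofLex s).1 = x.1 := by
  simp only [posPairs, Finset.mem_filter, Finset.mem_univ, true_and] at hs
  simp [replaceTwo, Function.update_of_ne hs.ne]

theorem replaceTwo_of_ne {c : Fin k} (h1 : c ≠ (ofLex s).1) (h2 : c ≠ (ofLex s).2) :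
    replaceTwo i s x c = i c := by
  simp [replaceTwo, h1, h2]

variable {i x}

/-- At the other positions both tuples agree. If a new entry of `y` occurred in the first tuple at
such a position, it would occur twice in the second tuple, against injectivity. -/
theorem mem_of_image_replaceTwo_eq (hs : s ∈ posPairs k) {y : Fin n × Fin n}
    (hy : Function.Injective (replaceTwo i s y))
    {B B' : Finset (Fin k)} (hB' : B' ∈ spanning s)
    (h : B.image (replaceTwo i s x) = B'.image (replaceTwo i s y)) :
    (y.1 = x.1 ∨ y.1 = x.2) ∧ (y.2 = x.1 ∨ y.2 = x.2) := by
  have hs' := hs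
  simp only [posPairs, Finset.mem_filter, Finset.mem_univ, true_and] at hs'
  simp only [spanning, Finset.mem_filter, Finset.mem_univ, true_and] at hB'
  have key : ∀ l ∈ B', (l = (ofLex s).1 ∨ l = (ofLex s).2) →
      replaceTwo i s y l = x.1 ∨ replaceTwo i s y l = x.2 := by
    intro l hl hl'
    have : replaceTwo i s y l ∈ B.image (replaceTwo i s x) := by
      rw [h]; exact Finset.mem_image_of_mem _ hl
    obtain ⟨c, -, hc⟩ := Finset.mem_image.1 this
    by_cases h1 : c = (ofLex s).1
    · subst h1
      rw [replaceTwo_fst _ _ hs] at hc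
      exact Or.inl hc.symm
    by_cases h2 : c = (ofLex s).2
    · subst h2
      rw [replaceTwo_snd] at hc
      exact Or.inr hc.symm
    exfalso
    rw [replaceTwo_of_ne i x h1 h2, ← replaceTwo_of_ne i y h1 h2] at hc
    have := hy hc
    subst this
    rcases hl' with h | h <;> contradiction
  have k1 := key _ hB'.1 (Or.inl rfl)
  have k2 := key _ hB'.2.1 (Or.inr rfl)
  rw [replaceTwo_fst _ _ hs] at k1
  rw [replaceTwo_snd] at k2
  exact ⟨k1, k2⟩

/-- The coins that span `s` in one tuple are different from the coins that span `r` in another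
tuple that differs from the first one only at the positions `s`. -/
theorem disjoint_spanCoins_replaceTwo (hs : s ∈ posPairs k) {r : Fin k ×ₗ Fin k}
    {y : Fin n × Fin n} (hx : Function.Injective (replaceTwo i s x))
    (hy : Function.Injective (replaceTwo i s y))
    (hxy : x.1 < x.2 ↔ y.1 < y.2) (hne : y ≠ x ∨ r ≠ s) :
    Disjoint (spanCoins (replaceTwo i s y) s) (spanCoins (replaceTwo i s x) r) := by
  rw [Finset.disjoint_left]
  intro A hA hA'
  obtain ⟨B', hB', rfl⟩ := Finset.mem_image.1 hA
  obtain ⟨B, hB, h⟩ := Finset.mem_image.1 hA'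
  have hm := mem_of_image_replaceTwo_eq hs hy hB' h
  have hs' := hs
  simp only [posPairs, Finset.mem_filter, Finset.mem_univ, true_and] at hs'
  have hyne : y.1 ≠ y.2 := by
    rw [← replaceTwo_fst i y hs, ← replaceTwo_snd (s := s) i y]
    exact fun h => hs'.ne (hy h)
  -- The entries of `y` are distinct and lie among those of `x`, so `y` is `x` or its swap; the
  -- common order type excludes the swap.
  have hyx : y = x := by
    apply Prod.ext <;> grind
  subst hyx
  have := Finset.image_injective hx h
  subst this
  rcases hne with h | h
  · exact h rfl
  · exact h (spanning_unique hB hB')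

end Replace

/-! ### Concentration of the random complex in cut norm. -/

section Concentration

variable {n k : ℕ} {p : Finset (Fin n) → ℝ}

theorem spanProb_mem_Icc (hp : ∀ A, p A ∈ Set.Icc (0 : ℝ) 1) (i : Fin k → Fin n)
    (s : Fin k ×ₗ Fin k) : spanProb p i s ∈ Set.Icc (0 : ℝ) 1 :=
  ⟨Finset.prod_nonneg fun A _ => (hp A).1,
    Finset.prod_le_one (fun A _ => (hp A).1) fun A _ => (hp A).2⟩

/-- The variance proxy of a telescoping term. -/
noncomputable def hybridVar (p : Finset (Fin n) → ℝ) (s : Fin k ×ₗ Fin k) (i : Fin k → Fin n) :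
    ℝ :=
  (1 - spanProb p i s) * ∏ r ∈ posPairs k with r < s, spanProb p i r

theorem hybridVar_nonneg (hp : ∀ A, p A ∈ Set.Icc (0 : ℝ) 1) (s : Fin k ×ₗ Fin k)
    (i : Fin k → Fin n) : 0 ≤ hybridVar p s i :=
  mul_nonneg (sub_nonneg.2 (spanProb_mem_Icc hp i s).2)
    (Finset.prod_nonneg fun r _ => (spanProb_mem_Icc hp i r).1)

/-- In a sequence of independent trials with success probabilities `spanProb p i s`, the summand is
the probability that the first failure occurs at `s`. This removes a factor of the number of pairs
from the variance term. -/
theorem sum_hybridVar_le (hp : ∀ A, p A ∈ Set.Icc (0 : ℝ) 1) (i : Fin k → Fin n) :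
    ∑ s ∈ posPairs k, hybridVar p s i ≤ 1 := by
  have := Finset.prod_one_sub_ordered (posPairs k) fun s => 1 - spanProb p i s
  simp only [sub_sub_cancel] at this
  have h : 0 ≤ ∏ s ∈ posPairs k, spanProb p i s :=
    Finset.prod_nonneg fun r _ => (spanProb_mem_Icc hp i r).1
  simp only [hybridVar]
  linarith

/-- The exponential moments of the sum of the telescoping terms over tuples that differ only at the
positions `s`. -/
theorem coinExp_exp_hybrid_le (hp : ∀ A, p A ∈ Set.Icc (0 : ℝ) 1) {s : Fin k ×ₗ Fin k}
    (hs : s ∈ posPairs k) (i : Fin k → Fin n) (D : Finset (Fin n × Fin n))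
    (hD : ∀ x ∈ D, Function.Injective (replaceTwo i s x))
    (hlt : ∀ x ∈ D, ∀ y ∈ D, (x.1 < x.2 ↔ y.1 < y.2))
    {c : ℝ} (hc : |c| ≤ 2 / 5) (b : Fin n × Fin n → ℝ) (hb : ∀ x, b x ∈ Set.Icc (0 : ℝ) 1) :
    coinExp p (fun ω => Real.exp (c * ∑ x ∈ D, b x * hybridTerm p s (replaceTwo i s x) ω))
      ≤ Real.exp (3 / 5 * c ^ 2 * ∑ x ∈ D, hybridVar p s (replaceTwo i s x)) := by
  set θ : Fin n × Fin n → (Finset (Fin n) → Bool) → ℝ := fun x ω =>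
    c * b x * (∏ r ∈ posPairs k with r < s, spanProb p (replaceTwo i s x) r) *
      ∏ r ∈ posPairs k with s < r, allHeads (spanCoins (replaceTwo i s x) r) ω with hθ
  have ha : ∀ x, (∏ r ∈ posPairs k with r < s, spanProb p (replaceTwo i s x) r)
      ∈ Set.Icc (0 : ℝ) 1 := fun x =>
    ⟨Finset.prod_nonneg fun r _ => (spanProb_mem_Icc hp _ r).1,
      Finset.prod_le_one (fun r _ => (spanProb_mem_Icc hp _ r).1)
        fun r _ => (spanProb_mem_Icc hp _ r).2⟩
  have he : ∀ x ω, (∏ r ∈ posPairs k with s < r, allHeads (spanCoins (replaceTwo i s x) r) ω)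
      ∈ Set.Icc (0 : ℝ) 1 := fun x ω =>
    ⟨Finset.prod_nonneg fun r _ => (allHeads_mem_Icc _ ω).1,
      Finset.prod_le_one (fun r _ => (allHeads_mem_Icc _ ω).1)
        fun r _ => (allHeads_mem_Icc _ ω).2⟩
  have hmain := coinExp_prod_exp_le hp D (fun x => spanCoins (replaceTwo i s x) s) θ
    (fun x => c ^ 2 * hybridVar p s (replaceTwo i s x)) ?_ ?_ ?_ ?_
  · refine le_trans (le_of_eq ?_) (hmain.trans (le_of_eq ?_))
    · congr 1
      funext ω
      rw [← Real.exp_sum, Finset.mul_sum]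
      congr 1
      refine Finset.sum_congr rfl fun x _ => ?_
      simp only [hθ, hybridTerm, spanProb]
      ring
    · rw [← Real.exp_sum, Finset.mul_sum]
      congr 1
      exact Finset.sum_congr rfl fun x _ => by ring
  · exact fun x hx y hy hxy => disjoint_spanCoins_replaceTwo hs (hD y hy) (hD x hx)
      (hlt y hy x hx) (Or.inl hxy)
  · intro x hx y hy
    refine ((Insensitive.const _ _)).mul (Insensitive.prod _ fun r hr => insensitive_allHeads ?_)
    exact disjoint_spanCoins_replaceTwo hs (hD y hy) (hD x hx)
      (hlt y hy x hx) (Or.inr (Finset.mem_filter.1 hr).2.ne')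
  · intro x _ ω
    simp only [hθ, abs_mul, abs_of_nonneg (hb x).1, abs_of_nonneg (ha x).1,
      abs_of_nonneg (he x ω).1]
    refine le_trans (mul_le_of_le_one_right (by have := (hb x).1; have := (ha x).1; positivity)
      (he x ω).2) ?_
    refine le_trans (mul_le_of_le_one_right (by have := (hb x).1; positivity) (ha x).2) ?_
    exact (mul_le_of_le_one_right (abs_nonneg c) (hb x).2).trans hc
  · intro x _ ω
    have hq := spanProb_mem_Icc hp (replaceTwo i s x) s
    change θ x ω ^ 2 * (spanProb p (replaceTwo i s x) s * (1 - spanProb p (replaceTwo i s x) s)) ≤ _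
    simp only [hθ, hybridVar]
    set A := ∏ r ∈ posPairs k with r < s, spanProb p (replaceTwo i s x) r
    set E := ∏ r ∈ posPairs k with s < r, allHeads (spanCoins (replaceTwo i s x) r) ω
    set q := spanProb p (replaceTwo i s x) s
    have hA := ha x
    have hE := he x ω
    have hbx := hb x
    -- The variance is `c² (b E)² A² q (1 - q)`. One factor `A` is kept outside this estimate, since
    -- `(1 - q) A` is what telescopes.
    have h1 : (b x * E) ^ 2 * A * q ≤ 1 := by
      have : b x * E ≤ 1 := mul_le_one₀ hbx.2 hE.1 hE.2
      have h2 : (b x * E) ^ 2 ≤ 1 := pow_le_one₀ (mul_nonneg hbx.1 hE.1) this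
      exact mul_le_one₀ (mul_le_one₀ h2 hA.1 hA.2) hq.1 hq.2
    have h2 : 0 ≤ c ^ 2 * ((1 - q) * A) :=
      mul_nonneg (sq_nonneg c) (mul_nonneg (sub_nonneg.2 hq.2) hA.1)
    calc _ = (c ^ 2 * ((1 - q) * A)) * ((b x * E) ^ 2 * A * q) := by ring
      _ ≤ _ := mul_le_of_le_one_right h2 h1

/-- The form is bilinear in `f` and `g`, so it suffices to control the `4 ^ n` pairs of indicator
vectors. Counting both signs, the maximal inequality involves `2 ^ (2 * n + 1)` events, whence the
logarithm. Varying only two positions keeps `k` out of this count. -/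
theorem exists_majorant_hybrid (hp : ∀ A, p A ∈ Set.Icc (0 : ℝ) 1) {s : Fin k ×ₗ Fin k}
    (hs : s ∈ posPairs k) (i : Fin k → Fin n) (D : Finset (Fin n × Fin n))
    (hD : ∀ x ∈ D, Function.Injective (replaceTwo i s x))
    (hlt : ∀ x ∈ D, ∀ y ∈ D, (x.1 < x.2 ↔ y.1 < y.2))
    {c : ℝ} (hc0 : 0 < c) (hc : c ≤ 2 / 5) :
    ∃ M : (Finset (Fin n) → Bool) → ℝ,
      (∀ ω (f g : Fin n → ℝ), (∀ u, f u ∈ Set.Icc (0 : ℝ) 1) → (∀ u, g u ∈ Set.Icc (0 : ℝ) 1) →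
        |∑ x ∈ D, f x.1 * g x.2 * hybridTerm p s (replaceTwo i s x) ω| ≤ M ω) ∧
      coinExp p M ≤ (2 * n + 1) * Real.log 2 / c
        + 3 / 5 * c * ∑ x ∈ D, hybridVar p s (replaceTwo i s x) := by
  set X : Finset (Fin n) × Finset (Fin n) → (Finset (Fin n) → Bool) → ℝ := fun j ω =>
    ∑ x ∈ D, (if x.1 ∈ j.1 ∧ x.2 ∈ j.2 then 1 else 0) * hybridTerm p s (replaceTwo i s x) ω
    with hX
  have hmgf : ∀ e : ℝ, |e| = c → ∀ j, coinExp p (fun ω => Real.exp (e * X j ω))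
      ≤ Real.exp (3 / 5 * c ^ 2 * ∑ x ∈ D, hybridVar p s (replaceTwo i s x)) := by
    intro e he j
    rw [← he, sq_abs]
    exact coinExp_exp_hybrid_le hp hs i D hD hlt (he.trans_le hc) _
      fun x => by split_ifs <;> simp
  obtain ⟨M, hM, hE⟩ := exists_majorant X hc0 (hmgf c (abs_of_pos hc0))
    (hmgf (-c) (by rw [abs_neg, abs_of_pos hc0]))
  refine ⟨M, fun ω f g hf hg => ?_, hE.trans (le_of_eq ?_)⟩
  · set y : Fin n → Fin n → ℝ := fun u v =>
      if (u, v) ∈ D then hybridTerm p s (replaceTwo i s (u, v)) ω else 0 with hy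
    have hsum : ∀ (h : Fin n × Fin n → ℝ),
        ∑ x ∈ D, h x * hybridTerm p s (replaceTwo i s x) ω = ∑ u, ∑ v, h (u, v) * y u v := by
      intro h
      rw [← Fintype.sum_prod_type' (f := fun u v => h (u, v) * y u v)]
      simp only [hy, mul_ite, mul_zero, Prod.mk.eta]
      rw [← Finset.sum_filter]
      simp
    obtain ⟨S, T, hST⟩ := exists_subset_abs_bilin_le y f g hf hg
    rw [hsum fun x => f x.1 * g x.2]
    refine hST.trans (le_trans (le_of_eq ?_) (hM ω (S, T)))
    simp only [hX, hsum]
    congr 1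
    simp only [ite_and, ite_mul, one_mul, zero_mul]
    have : ∀ u, ∑ v, (if u ∈ S then if v ∈ T then y u v else 0 else 0)
        = if u ∈ S then ∑ v ∈ T, y u v else 0 := by
      intro u
      split_ifs <;> simp
    simp [this]
  · have : (Fintype.card (Finset (Fin n) × Finset (Fin n)) : ℝ) = 2 ^ (2 * n) := by
      simp [two_mul, pow_add]
    rw [this, ← pow_succ', Real.log_pow]
    push_cast
    field_simp

end Concentration

section Concentration

variable {n k : ℕ} {p : Finset (Fin n) → ℝ}

theorem prod_replaceTwo (f : Fin k → Fin n → ℝ) {s : Fin k ×ₗ Fin k} (hs : s ∈ posPairs k)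
    (i : Fin k → Fin n) (x : Fin n × Fin n) :
    ∏ l, f l (replaceTwo i s x l) = (∏ l with l ≠ (ofLex s).1 ∧ l ≠ (ofLex s).2, f l (i l)) *
      f (ofLex s).1 x.1 * f (ofLex s).2 x.2 := by
  have hs' := hs
  simp only [posPairs, Finset.mem_filter, Finset.mem_univ, true_and] at hs'
  rw [← Finset.prod_filter_mul_prod_filter_not Finset.univ
    (fun l => l ≠ (ofLex s).1 ∧ l ≠ (ofLex s).2), mul_assoc]
  congr 1
  · refine Finset.prod_congr rfl fun l hl => ?_
    obtain ⟨h1, h2⟩ := (Finset.mem_filter.1 hl).2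
    rw [replaceTwo_of_ne i x h1 h2]
  · have : (Finset.univ.filter fun l => ¬(l ≠ (ofLex s).1 ∧ l ≠ (ofLex s).2))
        = {(ofLex s).1, (ofLex s).2} := by
      ext l
      simp only [Finset.mem_filter, Finset.mem_univ, true_and, Finset.mem_insert,
        Finset.mem_singleton]
      tauto
    rw [this, Finset.prod_pair hs'.ne, replaceTwo_fst _ _ hs, replaceTwo_snd]

/-- Two applications of `sum_sum_update`: a sum over all tuples is an average of sums in which only
two positions vary. -/
theorem sum_sum_replaceTwo (F : (Fin k → Fin n) → ℝ) (s : Fin k ×ₗ Fin k) :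
    ∑ i, ∑ x, F (replaceTwo i s x) = (n : ℝ) ^ 2 * ∑ i, F i := by
  have h1 := sum_sum_update F (ofLex s).2
  have h2 := sum_sum_update (fun i => ∑ v, F (Function.update i (ofLex s).2 v)) (ofLex s).1
  simp only [Fintype.card_fin] at h1 h2
  rw [h1] at h2
  simp only [Fintype.sum_prod_type, replaceTwo]
  rw [h2]
  ring

/-- Average the two-position estimate over the remaining entries. The pairs `(u, v)` are split
according to whether `u < v`, since swapped pairs can share coins; this costs the factor 2. -/
theorem exists_majorant_pair (hn : 0 < n) (hp : ∀ A, p A ∈ Set.Icc (0 : ℝ) 1)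
    {s : Fin k ×ₗ Fin k} (hs : s ∈ posPairs k) {c : ℝ} (hc0 : 0 < c) (hc : c ≤ 2 / 5) :
    ∃ M : (Finset (Fin n) → Bool) → ℝ,
      (∀ ω (f : Fin k → Fin n → ℝ), (∀ l u, f l u ∈ Set.Icc (0 : ℝ) 1) →
        |∑ i : Fin k → Fin n with Function.Injective i,
          (∏ l, f l (i l)) * hybridTerm p s i ω| ≤ M ω) ∧
      coinExp p M ≤ (n : ℝ) ^ k * (2 * ((2 * n + 1) * Real.log 2) / (c * n ^ 2))
        + 3 / 5 * c * ∑ i : Fin k → Fin n, hybridVar p s i := by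
  classical
  set D : (Fin k → Fin n) → Bool → Finset (Fin n × Fin n) := fun i b =>
    Finset.univ.filter fun x => Function.Injective (replaceTwo i s x) ∧ decide (x.1 < x.2) = b
    with hD
  have hex := fun i b => exists_majorant_hybrid hp hs i (D i b)
    (fun x hx => (Finset.mem_filter.1 hx).2.1)
    (fun x hx y hy => by
      have h1 := (Finset.mem_filter.1 hx).2.2
      have h2 := (Finset.mem_filter.1 hy).2.2
      rw [← h2] at h1
      simpa using h1) hc0 hc
  choose M hM hE using hex
  have hn2 : (0 : ℝ) < (n : ℝ) ^ 2 := by positivity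
  have hsplit : ∀ (i : Fin k → Fin n) (H : Fin n × Fin n → ℝ),
      ∑ x with Function.Injective (replaceTwo i s x), H x = ∑ b, ∑ x ∈ D i b, H x := by
    intro i H
    rw [← Finset.sum_fiberwise _ (fun x : Fin n × Fin n => decide (x.1 < x.2))]
    simp only [hD, Finset.filter_filter]
  refine ⟨fun ω => ((n : ℝ) ^ 2)⁻¹ * ∑ i, ∑ b, M i b ω, fun ω f hf => ?_, ?_⟩
  · have h1 := sum_sum_replaceTwo (fun i : Fin k → Fin n => if Function.Injective i then
      (∏ l, f l (i l)) * hybridTerm p s i ω else 0) s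
    rw [← Finset.sum_filter] at h1
    have h2 : ∀ i : Fin k → Fin n, |∑ x, if Function.Injective (replaceTwo i s x) then
        (∏ l, f l (replaceTwo i s x l)) * hybridTerm p s (replaceTwo i s x) ω else 0|
        ≤ ∑ b, M i b ω := by
      intro i
      rw [← Finset.sum_filter, hsplit]
      refine (Finset.abs_sum_le_sum_abs _ _).trans (Finset.sum_le_sum fun b _ => ?_)
      simp only [prod_replaceTwo f hs]
      have hC0 : 0 ≤ ∏ l with l ≠ (ofLex s).1 ∧ l ≠ (ofLex s).2, f l (i l) :=
        Finset.prod_nonneg fun l _ => (hf l _).1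
      have hC1 : ∏ l with l ≠ (ofLex s).1 ∧ l ≠ (ofLex s).2, f l (i l) ≤ 1 :=
        Finset.prod_le_one (fun l _ => (hf l _).1) fun l _ => (hf l _).2
      -- The weights at the fixed positions form a constant in `[0,1]`, which is absorbed into the
      -- first varying weight.
      exact hM i b ω (fun u => (∏ l with l ≠ (ofLex s).1 ∧ l ≠ (ofLex s).2, f l (i l)) *
        f (ofLex s).1 u) (f (ofLex s).2)
        (fun u => ⟨mul_nonneg hC0 (hf _ _).1, mul_le_one₀ hC1 (hf _ _).1 (hf _ _).2⟩) (hf _)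
    beta_reduce
    rw [inv_mul_eq_div, le_div_iff₀ hn2, mul_comm, ← abs_of_pos hn2, ← abs_mul, ← h1]
    exact (Finset.abs_sum_le_sum_abs _ _).trans (Finset.sum_le_sum fun i _ => h2 i)
  · rw [coinExp_const_mul, coinExp_sum, inv_mul_eq_div, div_le_iff₀ hn2]
    have h3 : ∀ i, coinExp p (fun ω => ∑ b, M i b ω) ≤ 2 * ((2 * n + 1) * Real.log 2 / c)
        + 3 / 5 * c * ∑ x, hybridVar p s (replaceTwo i s x) := by
      intro i
      rw [coinExp_sum]
      refine (Finset.sum_le_sum fun b _ => hE i b).trans ?_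
      rw [Finset.sum_add_distrib, ← Finset.mul_sum, ← hsplit]
      refine add_le_add (by simp [two_mul]) (mul_le_mul_of_nonneg_left ?_ (by positivity))
      exact Finset.sum_le_sum_of_subset_of_nonneg (Finset.filter_subset _ _)
        fun x _ _ => hybridVar_nonneg hp _ _
    refine (Finset.sum_le_sum fun i _ => h3 i).trans (le_of_eq ?_)
    rw [Finset.sum_add_distrib, Finset.sum_const, ← Finset.mul_sum, sum_sum_replaceTwo]
    simp only [Finset.card_univ, Fintype.card_fun, Fintype.card_fin, nsmul_eq_mul]
    push_cast
    field_simp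

/-- Concentration of the random simplicial complex: in expectation, the indicators that the
`k`-tuples are simplices are close in the cut norm to their probabilities. -/
theorem exists_majorant_tuples (hn : 0 < n) (hp : ∀ A, p A ∈ Set.Icc (0 : ℝ) 1) (k : ℕ)
    {c : ℝ} (hc0 : 0 < c) (hc : c ≤ 2 / 5) :
    ∃ M : (Finset (Fin n) → Bool) → ℝ,
      (∀ ω (f : Fin k → Fin n → ℝ), (∀ l u, f l u ∈ Set.Icc (0 : ℝ) 1) →
        |∑ i : Fin k → Fin n with Function.Injective i,
          (∏ l, f l (i l)) * (allHeads (allCoins i) ω - ∏ A ∈ allCoins i, p A)| ≤ M ω) ∧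
      coinExp p M ≤ (n : ℝ) ^ k *
        (k * (k - 1) * ((2 * n + 1) * Real.log 2) / (c * n ^ 2) + 3 / 5 * c) := by
  classical
  have hex := fun s (hs : s ∈ posPairs k) => exists_majorant_pair hn hp hs hc0 hc
  choose! M hM hE using hex
  refine ⟨fun ω => ∑ s ∈ posPairs k, M s ω, fun ω f hf => ?_, ?_⟩
  · have : ∑ i : Fin k → Fin n with Function.Injective i,
          (∏ l, f l (i l)) * (allHeads (allCoins i) ω - ∏ A ∈ allCoins i, p A)
        = ∑ s ∈ posPairs k, ∑ i : Fin k → Fin n with Function.Injective i,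
          (∏ l, f l (i l)) * hybridTerm p s i ω := by
      rw [Finset.sum_comm]
      refine Finset.sum_congr rfl fun i hi => ?_
      rw [sum_hybridTerm p (Finset.mem_filter.1 hi).2, Finset.mul_sum]
    rw [this]
    exact (Finset.abs_sum_le_sum_abs _ _).trans
      (Finset.sum_le_sum fun s hs => hM s hs ω f hf)
  · rw [coinExp_sum]
    refine (Finset.sum_le_sum hE).trans ?_
    rw [Finset.sum_add_distrib, Finset.sum_const, ← Finset.mul_sum, Finset.sum_comm, nsmul_eq_mul]
    -- Summing over `s` first, the variances contribute at most 1 per tuple; only the entropy term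
    -- is multiplied by the number `k (k - 1) / 2` of pairs.
    have h1 : ∑ i : Fin k → Fin n, ∑ s ∈ posPairs k, hybridVar p s i ≤ (n : ℝ) ^ k :=
      (Finset.sum_le_sum fun i _ => sum_hybridVar_le hp i).trans (by simp)
    have h2 := mul_le_mul_of_nonneg_left h1 (by positivity : 0 ≤ 3 / 5 * c)
    rw [← card_posPairs]
    refine (add_le_add_right h2 _).trans (le_of_eq ?_)
    field_simp

end Concentration

/-! ### Equipartitions and measure-preserving maps with a prescribed joint law. -/

section Equipartition

variable {k : ℕ} {P : Fin k → Set unitInterval}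

/-- The index of the part of a partition to which a point belongs. -/
noncomputable def partIndex (hP : IsEquipartition P) (t : unitInterval) : Fin k :=
  (Set.mem_iUnion.1 (hP.cover.symm ▸ Set.mem_univ t : t ∈ ⋃ i, P i)).choose

theorem mem_partIndex (hP : IsEquipartition P) (t : unitInterval) : t ∈ P (partIndex hP t) :=
  (Set.mem_iUnion.1 (hP.cover.symm ▸ Set.mem_univ t : t ∈ ⋃ i, P i)).choose_spec

theorem mem_part_iff (hP : IsEquipartition P) (t : unitInterval) (a : Fin k) :
    t ∈ P a ↔ partIndex hP t = a := by
  refine ⟨fun h => ?_, fun h => h ▸ mem_partIndex hP t⟩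
  by_contra hne
  exact Set.disjoint_left.1 (hP.disjoint hne) (mem_partIndex hP t) h

theorem partIndex_preimage (hP : IsEquipartition P) (a : Fin k) :
    partIndex hP ⁻¹' {a} = P a := by
  ext t
  simp [mem_part_iff hP]

theorem IsEquipartition.pos (hP : IsEquipartition P) : 0 < k :=
  Fin.pos (partIndex hP 0)

theorem IsEquipartition.volume_part (hP : IsEquipartition P) (a : Fin k) :
    volume (P a) = (k : ENNReal)⁻¹ := by
  have h1 : volume (⋃ i, P i) = ∑ i, volume (P i) := by
    rw [measure_iUnion hP.disjoint hP.measurableSet, tsum_fintype]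
  rw [hP.cover, measure_univ, Finset.sum_congr rfl fun i _ => hP.volume_eq i a] at h1
  simp only [Finset.sum_const, Finset.card_univ, Fintype.card_fin, nsmul_eq_mul] at h1
  exact ENNReal.eq_inv_of_mul_eq_one_left (by rw [mul_comm]; exact h1.symm)

theorem IsEquipartition.measureReal_part (hP : IsEquipartition P) (a : Fin k) :
    volume.real (P a) = (k : ℝ)⁻¹ := by
  simp [Measure.real, hP.volume_part a]

theorem IsEquipartition.nonempty_part (hP : IsEquipartition P) (a : Fin k) : (P a).Nonempty := by
  by_contra h
  rw [Set.not_nonempty_iff_eq_empty] at h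
  have := hP.volume_part a
  rw [h, measure_empty] at this
  exact ENNReal.inv_ne_zero.2 (ENNReal.natCast_ne_top k) this.symm

end Equipartition

/-- The integral over a box of a function that depends only on finitely many types of the
coordinates. -/
theorem setIntegral_pi_comp {k : ℕ} {T : Type*} [Fintype T] (S : Fin k → Set unitInterval)
    (θ : unitInterval → T) (hθ : ∀ t, MeasurableSet (θ ⁻¹' {t}))
    (G : (Fin k → T) → ℝ) :
    ∫ x in Set.univ.pi S, G (fun l => θ (x l))
      = ∑ t : Fin k → T, (∏ l, volume.real (S l ∩ θ ⁻¹' {t l})) * G t := by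
  classical
  have hmeas : ∀ t : Fin k → T, MeasurableSet (Set.univ.pi fun l => θ ⁻¹' {t l}) :=
    fun t => MeasurableSet.univ_pi fun l => hθ (t l)
  have h1 : ∀ x : Fin k → unitInterval, G (fun l => θ (x l))
      = ∑ t : Fin k → T, (Set.univ.pi fun l => θ ⁻¹' {t l}).indicator (fun _ => G t) x := by
    intro x
    rw [Finset.sum_eq_single (fun l => θ (x l))]
    · rw [Set.indicator_of_mem]
      simp
    · intro t _ ht
      rw [Set.indicator_of_notMem]
      intro h
      exact ht (funext fun l => by simpa using (h l (Set.mem_univ l)).symm)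
    · simp
  simp only [h1]
  rw [integral_finsetSum _ fun t _ => (integrable_const (G t)).indicator (hmeas t)]
  refine Finset.sum_congr rfl fun t _ => ?_
  rw [integral_indicator_const _ (hmeas t), smul_eq_mul, Measure.real,
    Measure.restrict_apply (hmeas t), Set.inter_comm, ← Set.pi_inter_distrib, volume_pi_pi,
    ENNReal.toReal_prod]
  rfl

/-- Take `F` to be the distribution function of `ν`. Domination by Lebesgue measure makes it
Lipschitz, hence continuous, and a continuous distribution function pushes its own measure to the
uniform one: `{F ≤ s}` is an initial segment `Iic t` with `F t = s`. -/
theorem exists_map_eq_volume (ν : Measure unitInterval) [IsProbabilityMeasure ν] (C : NNReal)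
    (hν : ν ≤ C • volume) :
    ∃ F : unitInterval → unitInterval, Measurable F ∧ ν.map F = volume := by
  set F : unitInterval → unitInterval := fun t =>
    ⟨ν.real (Set.Iic t), measureReal_nonneg, measureReal_le_one⟩ with hF
  have hmono : Monotone F := fun s t hst =>
    Subtype.mk_le_mk.2 (measureReal_mono (Set.Iic_subset_Iic.2 hst))
  have hlip : ∀ s t : unitInterval, s ≤ t → (F t : ℝ) - F s ≤ C * ((t : ℝ) - s) := by
    intro s t hst
    have h1 : ν.real (Set.Iic t) = ν.real (Set.Iic s) + ν.real (Set.Ioc s t) := by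
      rw [← Set.Iic_union_Ioc_eq_Iic hst, measureReal_union]
      · rw [Set.disjoint_left]
        exact fun x hx hx' => not_lt.2 hx hx'.1
      · exact measurableSet_Ioc
    have h2 : ν.real (Set.Ioc s t) ≤ C * ((t : ℝ) - s) := by
      have := hν (Set.Ioc s t)
      rw [Measure.smul_apply, unitInterval.volume_Ioc, ENNReal.smul_def, smul_eq_mul] at this
      have h3 := ENNReal.toReal_mono (by finiteness) this
      have hts : 0 ≤ (t : ℝ) - s := sub_nonneg.2 hst
      simpa [Measure.real, ENNReal.toReal_ofReal hts] using h3
    simp only [hF]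
    linarith
  have hcont : Continuous F := by
    refine (LipschitzWith.of_dist_le_mul (K := C) fun s t => ?_).continuous
    rw [Subtype.dist_eq, Subtype.dist_eq, Real.dist_eq, Real.dist_eq]
    rcases le_total s t with h | h
    · have h1 : (F s : ℝ) ≤ F t := hmono h
      have h2 : (s : ℝ) ≤ t := h
      rw [abs_sub_comm, abs_of_nonneg (sub_nonneg.2 h1), abs_sub_comm,
        abs_of_nonneg (sub_nonneg.2 h2)]
      exact hlip s t h
    · have h1 : (F t : ℝ) ≤ F s := hmono h
      have h2 : (t : ℝ) ≤ s := h
      rw [abs_of_nonneg (sub_nonneg.2 h1), abs_of_nonneg (sub_nonneg.2 h2)]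
      exact hlip t s h
  have hF0 : F 0 = 0 := by
    have := hν (Set.Iic 0)
    rw [Measure.smul_apply, unitInterval.volume_Iic] at this
    apply Subtype.ext
    simp only [hF]
    simp at this
    simp [Measure.real, this]
  have hF1 : F 1 = 1 := by
    apply Subtype.ext
    have : (Set.Iic 1 : Set unitInterval) = Set.univ := by ext x; simp [unitInterval.le_one']
    simp [hF, this]
  refine ⟨F, hcont.measurable, Measure.ext_of_Iic _ _ fun s => ?_⟩
  rw [Measure.map_apply hcont.measurable measurableSet_Iic, unitInterval.volume_Iic]
  obtain ⟨c, hc⟩ : ∃ c, F c = s :=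
    mem_range_of_exists_le_of_exists_ge hcont ⟨0, by rw [hF0]; exact unitInterval.nonneg'⟩
      ⟨1, by rw [hF1]; exact unitInterval.le_one'⟩
  have hclosed : IsClosed (F ⁻¹' Set.Iic s) := isClosed_Iic.preimage hcont
  obtain ⟨t, ht, htmax⟩ := hclosed.isCompact.exists_isGreatest ⟨c, hc.le⟩
  have hct : c ≤ t := htmax hc.le
  have hset : F ⁻¹' Set.Iic s = Set.Iic t :=
    Set.Subset.antisymm (fun x hx => htmax hx) fun x hx => (hmono hx).trans ht
  have hFt : F t = s := le_antisymm ht (hc ▸ hmono hct)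
  rw [hset, ← hFt, ← ofReal_measureReal]

/-- First make `ν` uniform, then use that every probability measure on a standard Borel space is an
image of Lebesgue measure. -/
theorem exists_map_eq_of_le_volume {Y : Type*} [MeasurableSpace Y] [StandardBorelSpace Y]
    [Nonempty Y] (ν : Measure unitInterval) [IsProbabilityMeasure ν] (C : NNReal)
    (hν : ν ≤ C • volume) (μ : Measure Y) [IsProbabilityMeasure μ] :
    ∃ h : unitInterval → Y, Measurable h ∧ ν.map h = μ := by
  obtain ⟨F, hF, hFν⟩ := exists_map_eq_volume ν C hν
  obtain ⟨f, hf, hfμ⟩ := Measure.exists_measurable_map_eq μ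
  exact ⟨f ∘ F, hf.comp hF, by rw [← Measure.map_map hf hF, hFν, hfμ]⟩

/-- Every joint law of a point of `Fin n`, a part of `PU` and a part of `PW` with uniform marginals
on the parts arises from a measure-preserving map. -/
theorem exists_measurePreserving_of_joint {n kU kW : ℕ}
    {PU : Fin kU → Set unitInterval} {PW : Fin kW → Set unitInterval} (hPU : IsEquipartition PU)
    (hPW : IsEquipartition PW) (ρ : Fin n → Fin kU → Fin kW → ℝ) (hρ : ∀ i a b, 0 ≤ ρ i a b)
    (hρU : ∀ a, ∑ i, ∑ b, ρ i a b = (kU : ℝ)⁻¹) (hρW : ∀ b, ∑ a, ∑ i, ρ i a b = (kW : ℝ)⁻¹) :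
    ∃ (φ : unitInterval → unitInterval) (ι : unitInterval → Fin n),
      MeasurePreserving φ volume volume ∧ Measurable ι ∧
      ∀ i a b, volume.real (ι ⁻¹' {i} ∩ PU a ∩ φ ⁻¹' PW b) = ρ i a b := by
  have hkU : 0 < kU := hPU.pos
  have hkW : 0 < kW := hPW.pos
  have hkU' : (0 : ℝ) < kU := by exact_mod_cast hkU
  have hkW' : (0 : ℝ) < kW := by exact_mod_cast hkW
  have hn : Nonempty (Fin n) := by
    by_contra h
    rw [not_nonempty_iff] at h
    have := hρU ⟨0, hkU⟩
    rw [Finset.univ_eq_empty, Finset.sum_empty] at this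
    exact (inv_pos.2 hkU').ne this
  -- The intended conditional law of the index and of the image point, given the part `a`: the pair
  -- `(i, b)` has probability `kU * ρ i a b`, and the image point is then uniform in `PW b`, with
  -- density `kW`.
  set μ : Fin kU → Measure (Fin n × unitInterval) := fun a => ∑ i, ∑ b,
    (kU * kW * ρ i a b).toNNReal • (Measure.dirac i).prod (volume.restrict (PW b)) with hμ
  have hμ_apply : ∀ a i (E : Set unitInterval), MeasurableSet E → (μ a).real ({i} ×ˢ E)
      = ∑ b, kU * kW * ρ i a b * volume.real (E ∩ PW b) := by
    intro a i E hE
    have : μ a ({i} ×ˢ E)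
        = ∑ b, ((kU * kW * ρ i a b).toNNReal : ENNReal) * volume (E ∩ PW b) := by
      simp only [hμ, Measure.coe_finsetSum, Finset.sum_apply, Measure.smul_apply,
        Measure.prod_prod, Measure.restrict_apply hE]
      rw [Finset.sum_eq_single i]
      · simp [ENNReal.smul_def]
      · intro j _ hj
        simp [hj]
      · simp
    rw [Measure.real, this, ENNReal.toReal_sum (fun b _ => by finiteness)]
    refine Finset.sum_congr rfl fun b _ => ?_
    rw [ENNReal.toReal_mul, ENNReal.coe_toReal, Real.coe_toNNReal _ (by have := hρ i a b; positivity)]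
    rfl
  have hfin : ∀ a, IsFiniteMeasure (μ a) := fun a => by
    simp only [hμ]
    infer_instance
  have hμ_univ : ∀ a, IsProbabilityMeasure (μ a) := by
    intro a
    have hU : (Set.univ : Set (Fin n × unitInterval)) = ⋃ i : Fin n, {i} ×ˢ Set.univ := by
      ext ⟨i, t⟩; simp
    have h1 : (μ a).real Set.univ = 1 := by
      rw [hU, measureReal_iUnion_fintype]
      · simp only [hμ_apply a _ _ MeasurableSet.univ, Set.univ_inter, hPW.measureReal_part]
        have : ∀ i b, (kU : ℝ) * kW * ρ i a b * (kW : ℝ)⁻¹ = kU * ρ i a b := by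
          intro i b; field_simp
        simp only [this, ← Finset.mul_sum, hρU a]
        field_simp
      · intro i j hij
        simp [Function.onFun, Set.disjoint_prod, hij]
      · exact fun i => (measurableSet_singleton i).prod MeasurableSet.univ
    refine ⟨?_⟩
    rw [← ofReal_measureReal, h1, ENNReal.ofReal_one]
  set ν : Fin kU → Measure unitInterval := fun a => (kU : NNReal) • volume.restrict (PU a) with hν
  have hν_prob : ∀ a, IsProbabilityMeasure (ν a) := by
    intro a
    refine ⟨?_⟩
    simp only [hν, Measure.smul_apply, Measure.restrict_apply_univ, hPU.volume_part a,
      ENNReal.smul_def, smul_eq_mul, ENNReal.coe_natCast]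
    exact ENNReal.mul_inv_cancel (by exact_mod_cast hkU.ne') (ENNReal.natCast_ne_top _)
  have hex : ∀ a, ∃ h : unitInterval → Fin n × unitInterval, Measurable h ∧ (ν a).map h = μ a :=
    fun a => exists_map_eq_of_le_volume (ν a) kU
      (by
        intro s
        simp only [hν, Measure.smul_apply, ENNReal.smul_def, smul_eq_mul]
        gcongr
        exact Measure.restrict_le_self) (μ a)
  choose h hmeas hmap using hex
  -- Each part of `PU` carries its own map onto its conditional law; the maps are glued along the
  -- parts.
  set g : unitInterval → Fin n × unitInterval := fun t => h (partIndex hPU t) t with hg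
  have hidx : Measurable (partIndex hPU) :=
    measurable_to_countable' fun a => by
      rw [partIndex_preimage]; exact hPU.measurableSet a
  have hgm : Measurable g := by
    have : Measurable fun x : Fin kU × unitInterval => h x.1 x.2 :=
      measurable_from_prod_countable_right fun a => hmeas a
    exact this.comp (hidx.prodMk measurable_id)
  have hkey : ∀ a i (E : Set unitInterval), MeasurableSet E →
      volume.real (PU a ∩ g ⁻¹' ({i} ×ˢ E)) = ∑ b, kW * ρ i a b * volume.real (E ∩ PW b) := by
    intro a i E hE
    have hiE : MeasurableSet ({i} ×ˢ E) := (measurableSet_singleton i).prod hE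
    have h1 : PU a ∩ g ⁻¹' ({i} ×ˢ E) = h a ⁻¹' ({i} ×ˢ E) ∩ PU a := by
      ext t
      simp only [Set.mem_inter_iff, Set.mem_preimage, hg]
      constructor
      · rintro ⟨ht, ht'⟩
        rw [(mem_part_iff hPU t a).1 ht] at ht'
        exact ⟨ht', ht⟩
      · rintro ⟨ht', ht⟩
        rw [(mem_part_iff hPU t a).1 ht]
        exact ⟨ht, ht'⟩
    have h2 := hμ_apply a i E hE
    rw [← hmap a, measureReal_def, Measure.map_apply (hmeas a) hiE] at h2
    simp only [hν, Measure.smul_apply, Measure.restrict_apply (hmeas a hiE), ENNReal.smul_def,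
      smul_eq_mul, ENNReal.toReal_mul, ENNReal.coe_natCast, ENNReal.toReal_natCast, ← h1] at h2
    rw [← measureReal_def] at h2
    have : ∑ b, (kU : ℝ) * kW * ρ i a b * volume.real (E ∩ PW b)
        = kU * ∑ b, kW * ρ i a b * volume.real (E ∩ PW b) := by
      rw [Finset.mul_sum]
      exact Finset.sum_congr rfl fun b _ => by ring
    rw [this] at h2
    exact mul_left_cancel₀ hkU'.ne' h2
  refine ⟨fun t => (g t).2, fun t => (g t).1, ⟨measurable_snd.comp hgm, ?_⟩,
    measurable_fst.comp hgm, ?_⟩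
  · ext E hE
    rw [Measure.map_apply (f := fun t => (g t).2) (measurable_snd.comp hgm) hE]
    have hsplit : (fun t => (g t).2) ⁻¹' E
        = ⋃ x : Fin kU × Fin n, PU x.1 ∩ g ⁻¹' ({x.2} ×ˢ E) := by
      ext t
      simp only [Set.mem_preimage, Set.mem_iUnion, Set.mem_inter_iff, Set.mem_prod,
        Set.mem_singleton_iff, Prod.exists]
      exact ⟨fun ht => ⟨partIndex hPU t, (g t).1, mem_partIndex hPU t, rfl, ht⟩,
        fun ⟨_, _, _, _, ht⟩ => ht⟩
    have hsplitE : E = ⋃ b, E ∩ PW b := by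
      rw [← Set.inter_iUnion, hPW.cover, Set.inter_univ]
    have h1 : volume.real ((fun t => (g t).2) ⁻¹' E) = volume.real E := by
      rw [hsplit, measureReal_iUnion_fintype]
      · simp only [hkey _ _ E hE, Fintype.sum_prod_type]
        have h3 : ∑ a, ∑ i, ∑ b, kW * ρ i a b * volume.real (E ∩ PW b)
            = ∑ b, (kW * volume.real (E ∩ PW b)) * ∑ a, ∑ i, ρ i a b := by
          simp only [Finset.mul_sum]
          rw [Finset.sum_congr rfl fun a _ => Finset.sum_comm, Finset.sum_comm]
          exact Finset.sum_congr rfl fun b _ => Finset.sum_congr rfl fun a _ =>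
            Finset.sum_congr rfl fun i _ => by ring
        rw [h3]
        simp only [hρW]
        conv_rhs => rw [hsplitE]
        rw [measureReal_iUnion_fintype]
        · exact Finset.sum_congr rfl fun b _ => by field_simp
        · intro b b' hb
          exact (hPW.disjoint hb).mono Set.inter_subset_right Set.inter_subset_right
        · exact fun b => hE.inter (hPW.measurableSet b)
      · rintro ⟨a, i⟩ ⟨a', i'⟩ hne
        rw [Function.onFun, Set.disjoint_left]
        rintro t ⟨h1, h2⟩ ⟨h3, h4⟩
        apply hne
        rw [mem_part_iff hPU] at h1 h3
        exact Prod.ext (h1.symm.trans h3) (h2.1.symm.trans h4.1)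
      · exact fun x => (hPU.measurableSet _).inter (hgm ((measurableSet_singleton _).prod hE))
    rw [← ofReal_measureReal, h1, ofReal_measureReal]
  · intro i a b
    have h1 : (fun t => (g t).1) ⁻¹' {i} ∩ PU a ∩ (fun t => (g t).2) ⁻¹' PW b
        = PU a ∩ g ⁻¹' ({i} ×ˢ PW b) := by
      ext t
      simp only [Set.mem_inter_iff, Set.mem_preimage, Set.mem_prod, Set.mem_singleton_iff]
      tauto
    rw [h1, hkey a i _ (hPW.measurableSet b), Finset.sum_eq_single b]
    · rw [Set.inter_self, hPW.measureReal_part]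
      field_simp
    · intro b' _ hb'
      rw [(hPW.disjoint hb'.symm).inter_eq]
      simp
    · simp

/-! ### Couplings of sampled indices with types, and alignment. -/

/-- The proportion of the indices that have the type `a`. -/
noncomputable def typeFreq {n k : ℕ} (u : Fin n → Fin k) (a : Fin k) : ℝ :=
  (Finset.univ.filter fun i => u i = a).card / n

/-- The total variation distance between the distribution of the types and the uniform one. -/
noncomputable def typeDev {n k : ℕ} (u : Fin n → Fin k) : ℝ :=
  (∑ a, |typeFreq u a - (k : ℝ)⁻¹|) / 2

section Coupling

variable {n k : ℕ}

theorem sum_comp_type (hn : 0 < n) (u : Fin n → Fin k) (g : Fin k → ℝ) :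
    ∑ i, (n : ℝ)⁻¹ * g (u i) = ∑ a, typeFreq u a * g a := by
  rw [← Finset.sum_fiberwise Finset.univ u]
  refine Finset.sum_congr rfl fun a _ => ?_
  rw [Finset.sum_congr rfl fun i hi => by rw [(Finset.mem_filter.1 hi).2], Finset.sum_const,
    nsmul_eq_mul, typeFreq]
  field_simp

theorem typeFreq_nonneg (u : Fin n → Fin k) (a : Fin k) : 0 ≤ typeFreq u a := by
  unfold typeFreq; positivity

theorem sum_typeFreq (hn : 0 < n) (u : Fin n → Fin k) : ∑ a, typeFreq u a = 1 := by
  have := sum_comp_type hn u fun _ => 1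
  simp only [mul_one, Finset.sum_const, Finset.card_univ, Fintype.card_fin, nsmul_eq_mul] at this
  rw [← this]
  field_simp

theorem typeDev_nonneg (u : Fin n → Fin k) : 0 ≤ typeDev u := by
  unfold typeDev; positivity

/-- The maximal coupling of the uniform distributions on the indices and on the types. -/
theorem exists_type_coupling (hn : 0 < n) (hk : 0 < k) (u : Fin n → Fin k) :
    ∃ c : Fin n → Fin k → ℝ, (∀ i a, 0 ≤ c i a) ∧ (∀ i, ∑ a, c i a = (n : ℝ)⁻¹) ∧
      (∀ a, ∑ i, c i a = (k : ℝ)⁻¹) ∧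
      ∑ i, ∑ a, (if a ≠ u i then c i a else 0) ≤ typeDev u := by
  have hn' : (0 : ℝ) < n := by exact_mod_cast hn
  have hk' : (0 : ℝ) < (k : ℝ)⁻¹ := inv_pos.2 (by exact_mod_cast hk)
  set e := typeFreq u with he
  set D : Fin k → ℝ := fun a => max ((k : ℝ)⁻¹ - e a) 0 with hD
  set E : Fin k → ℝ := fun a => max (e a - (k : ℝ)⁻¹) 0 with hE
  -- The probability that an index of type `a` keeps its type. For a type that does not occur, the
  -- quotient is 0 by convention, which is harmless since no index uses it.
  set s : Fin k → ℝ := fun a => min 1 ((k : ℝ)⁻¹ / e a) with hs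
  have he0 : ∀ a, 0 ≤ e a := typeFreq_nonneg u
  have hD0 : ∀ a, 0 ≤ D a := fun a => le_max_right _ _
  have hs0 : ∀ a, 0 ≤ s a := fun a => le_min zero_le_one (div_nonneg hk'.le (he0 a))
  have hs1 : ∀ a, s a ≤ 1 := fun a => min_le_left _ _
  have hes : ∀ a, e a * s a = min (e a) (k : ℝ)⁻¹ := by
    intro a
    rcases (he0 a).eq_or_lt with h | h
    · rw [← h, zero_mul, min_eq_left hk'.le]
    · simp only [hs]
      rw [mul_min_of_nonneg _ _ h.le, mul_one, mul_div_cancel₀ _ h.ne']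
  have hes' : ∀ a, e a * (1 - s a) = E a := by
    intro a
    rw [mul_sub, mul_one, hes]
    simp only [hE]
    rcases le_total (e a) (k : ℝ)⁻¹ with h | h
    · rw [min_eq_left h, max_eq_right (by linarith), sub_self]
    · rw [min_eq_right h, max_eq_left (by linarith)]
  have hsum0 : ∑ a, (e a - (k : ℝ)⁻¹) = 0 := by
    have hk0 : (k : ℝ) ≠ 0 := by exact_mod_cast hk.ne'
    rw [Finset.sum_sub_distrib, sum_typeFreq hn u]
    simp [hk0]
  have hED : ∑ a, E a = ∑ a, D a := by
    rw [← sub_eq_zero, ← Finset.sum_sub_distrib, ← hsum0]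
    refine Finset.sum_congr rfl fun a _ => ?_
    simp only [hE, hD]
    rcases le_total (e a) (k : ℝ)⁻¹ with h | h
    · rw [max_eq_right (by linarith), max_eq_left (by linarith)]; ring
    · rw [max_eq_left (by linarith), max_eq_right (by linarith)]; ring
  have hdev : typeDev u = ∑ a, E a := by
    have : ∑ a, |e a - (k : ℝ)⁻¹| = ∑ a, E a + ∑ a, D a := by
      rw [← Finset.sum_add_distrib]
      refine Finset.sum_congr rfl fun a _ => ?_
      simp only [hE, hD]
      rcases le_total (e a) (k : ℝ)⁻¹ with h | h
      · rw [max_eq_right (by linarith), max_eq_left (by linarith), abs_of_nonpos (by linarith)]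
        ring
      · rw [max_eq_left (by linarith), max_eq_right (by linarith), abs_of_nonneg (by linarith)]
        ring
    rw [typeDev, this, hED]
    ring
  set Δ := ∑ a, D a with hΔ
  have hΔ0 : 0 ≤ Δ := Finset.sum_nonneg fun a _ => hD0 a
  -- If `Δ = 0`, then `Δ / Δ` is 0; but then no type is overrepresented and every index keeps its
  -- type, so the left factor vanishes as well.
  have hcase : ∀ i, (1 - s (u i)) * (Δ / Δ) = 1 - s (u i) := by
    intro i
    rcases eq_or_ne Δ 0 with h | h
    · have h1 : E (u i) = 0 := by
        rw [h] at hED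
        exact (Finset.sum_eq_zero_iff_of_nonneg fun a _ => le_max_right _ _).1 hED _
          (Finset.mem_univ _)
      have h2 : e (u i) ≠ 0 := by
        have : 0 < (Finset.univ.filter fun j => u j = u i).card :=
          Finset.card_pos.2 ⟨i, by simp⟩
        simp only [he, typeFreq]
        positivity
      have h3 : 1 - s (u i) = 0 := by
        have := hes' (u i)
        rw [h1] at this
        exact (mul_eq_zero.1 this).resolve_left h2
      rw [h3, zero_mul]
    · rw [div_self h, mul_one]
  have hsumE : ∑ i, (n : ℝ)⁻¹ * (1 - s (u i)) = Δ := by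
    rw [sum_comp_type hn u fun a => 1 - s a, ← hED]
    exact Finset.sum_congr rfl fun a _ => hes' a
  -- An index that does not keep its type moves to an underrepresented one, with probability
  -- proportional to the deficit `D`.
  refine ⟨fun i a => (n : ℝ)⁻¹ * ((if a = u i then s a else 0) + (1 - s (u i)) * (D a / Δ)),
    fun i a => ?_, fun i => ?_, fun a => ?_, ?_⟩
  · refine mul_nonneg (inv_nonneg.2 hn'.le) (add_nonneg ?_ (mul_nonneg
      (sub_nonneg.2 (hs1 _)) (div_nonneg (hD0 a) hΔ0)))
    split_ifs <;> [exact hs0 a; exact le_rfl]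
  · rw [← Finset.mul_sum, Finset.sum_add_distrib, ← Finset.mul_sum, ← Finset.sum_div, ← hΔ,
      hcase]
    simp
  · have h1 : ∀ i, (n : ℝ)⁻¹ * ((if a = u i then s a else 0) + (1 - s (u i)) * (D a / Δ))
        = (n : ℝ)⁻¹ * (if u i = a then s a else 0)
          + (n : ℝ)⁻¹ * (1 - s (u i)) * (D a / Δ) := by
      intro i
      simp only [eq_comm (a := a)]
      ring
    simp only [h1]
    rw [Finset.sum_add_distrib, ← Finset.sum_mul, hsumE,
      sum_comp_type hn u fun b => if b = a then s a else 0]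
    simp only [mul_ite, mul_zero, Finset.sum_ite_eq', Finset.mem_univ, if_true]
    change e a * s a + _ = _
    have h2 : Δ * (D a / Δ) = D a := by
      rcases eq_or_ne Δ 0 with h | h
      · have : D a = 0 := (Finset.sum_eq_zero_iff_of_nonneg fun a _ => hD0 a).1 h _
          (Finset.mem_univ _)
        rw [this, zero_div, mul_zero]
      · field_simp
    rw [h2, hes]
    simp only [hD]
    rcases le_total (e a) (k : ℝ)⁻¹ with h | h
    · rw [min_eq_left h, max_eq_left (by linarith)]; ring
    · rw [min_eq_right h, max_eq_right (by linarith)]; ring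
  · rw [hdev, hED]
    refine (Finset.sum_le_sum fun i _ => ?_).trans hsumE.le
    have h1 : ∀ a, (if a ≠ u i then
        (n : ℝ)⁻¹ * ((if a = u i then s a else 0) + (1 - s (u i)) * (D a / Δ)) else 0)
        ≤ (n : ℝ)⁻¹ * ((1 - s (u i)) * (D a / Δ)) := by
      intro a
      split_ifs with h
      · rw [zero_add]
      · exact mul_nonneg (inv_nonneg.2 hn'.le) (mul_nonneg
          (sub_nonneg.2 (hs1 _)) (div_nonneg (hD0 a) hΔ0))
    refine (Finset.sum_le_sum fun a _ => h1 a).trans (le_of_eq ?_)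
    rw [← Finset.mul_sum, ← Finset.mul_sum, ← Finset.sum_div, ← hΔ, hcase]

/-- A union bound over pairs of positions: two given entries coincide in a proportion `1/n` of all
tuples. -/
theorem card_not_injective_le (n k : ℕ) :
    (n : ℝ) * (Finset.univ.filter fun i : Fin k → Fin n => ¬Function.Injective i).card
      ≤ k * (k - 1) / 2 * (n : ℝ) ^ k := by
  classical
  have hpair : ∀ s ∈ posPairs k, (n : ℝ) *
      (Finset.univ.filter fun i : Fin k → Fin n => i (ofLex s).1 = i (ofLex s).2).card
      = (n : ℝ) ^ k := by
    intro s hs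
    simp only [posPairs, Finset.mem_filter, Finset.mem_univ, true_and] at hs
    have := sum_sum_update
      (fun i : Fin k → Fin n => if i (ofLex s).1 = i (ofLex s).2 then (1 : ℝ) else 0) (ofLex s).1
    simpa [Function.update_of_ne hs.ne'] using this.symm
  have hsub : (Finset.univ.filter fun i : Fin k → Fin n => ¬Function.Injective i)
      ⊆ (posPairs k).biUnion fun s =>
        Finset.univ.filter fun i : Fin k → Fin n => i (ofLex s).1 = i (ofLex s).2 := by
    intro i hi
    simp only [Finset.mem_filter, Finset.mem_univ, true_and, Function.Injective, not_forall] at hi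
    obtain ⟨a, b, hab, hne⟩ := hi
    simp only [Finset.mem_biUnion, Finset.mem_filter, Finset.mem_univ, true_and, posPairs]
    rcases lt_or_gt_of_ne hne with h | h
    · exact ⟨toLex (a, b), h, hab⟩
    · exact ⟨toLex (b, a), h, hab.symm⟩
  have h1 : ((Finset.univ.filter fun i : Fin k → Fin n => ¬Function.Injective i).card : ℝ)
      ≤ ∑ s ∈ posPairs k,
        ((Finset.univ.filter fun i : Fin k → Fin n => i (ofLex s).1 = i (ofLex s).2).card : ℝ) := by
    exact_mod_cast (Finset.card_le_card hsub).trans Finset.card_biUnion_le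
  refine (mul_le_mul_of_nonneg_left h1 (Nat.cast_nonneg n)).trans (le_of_eq ?_)
  rw [Finset.mul_sum, Finset.sum_congr rfl hpair, Finset.sum_const, nsmul_eq_mul]
  linarith [congrArg (· * (n : ℝ) ^ k) (card_posPairs k)]

end Coupling

theorem Complexon.IsStepfunction.faceted {W : Complexon} {k : ℕ} {P : Fin k → Set unitInterval}
    (hW : W.IsStepfunction P) : W.faceted.IsStepfunction P := fun r x y h => by
  simp only [Complexon.faceted]
  exact Finset.prod_congr rfl fun σ _ => hW _ _ _ fun a i => h _ i

theorem prod_sum_with_factor {K T : Type*} [Fintype K] [DecidableEq K] [Fintype T] (ρ : T → ℝ)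
    (hρ : ∑ t, ρ t = 1) (g : T → ℝ) (l : K) :
    ∑ t : K → T, (∏ j, ρ (t j)) * g (t l) = ∑ t, ρ t * g t := by
  classical
  have h := Finset.prod_univ_sum (fun _ : K => (Finset.univ : Finset T))
    (fun j t => ρ t * if j = l then g t else 1)
  rw [Fintype.piFinset_univ] at h
  have h1 : ∀ t : K → T, ∏ j, ρ (t j) * (if j = l then g (t j) else 1)
      = (∏ j, ρ (t j)) * g (t l) := by
    intro t
    rw [Finset.prod_mul_distrib, Finset.prod_ite_eq' Finset.univ l, if_pos (Finset.mem_univ l)]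
  simp only [h1] at h
  rw [← h, ← Finset.mul_prod_erase _ _ (Finset.mem_univ l), Finset.prod_eq_one, mul_one]
  · simp
  · intro j hj
    simp [Finset.ne_of_mem_erase hj, hρ]

/-- The cost of replacing the types of the coordinates by the types of the sampled indices. -/
theorem sum_prod_mul_indicator_le {k : ℕ} {T : Type*} [Fintype T] (ρ : T → ℝ)
    (hρ1 : ∑ t, ρ t = 1) (bad : T → Prop) [DecidablePred bad] {δ : ℝ}
    (hδ : ∑ t, (if bad t then ρ t else 0) ≤ δ) (m : Fin k → T → ℝ)
    (hm : ∀ l t, m l t ∈ Set.Icc 0 (ρ t)) (X : (Fin k → T) → ℝ)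
    (hX1 : ∀ t, |X t| ≤ 1) (hX : ∀ t, (∀ l, ¬bad (t l)) → X t = 0) :
    |∑ t : Fin k → T, (∏ l, m l (t l)) * X t| ≤ k * δ := by
  have h1 : ∀ t : Fin k → T, |(∏ l, m l (t l)) * X t|
      ≤ ∑ j, (∏ l, ρ (t l)) * (if bad (t j) then 1 else 0) := by
    intro t
    have h0 : 0 ≤ ∏ l, m l (t l) := Finset.prod_nonneg fun l _ => (hm l _).1
    have h2 : ∏ l, m l (t l) ≤ ∏ l, ρ (t l) :=
      Finset.prod_le_prod (fun l _ => (hm l _).1) fun l _ => (hm l _).2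
    rw [abs_mul, abs_of_nonneg h0, ← Finset.mul_sum]
    refine mul_le_mul h2 ?_ (abs_nonneg _) (h0.trans h2)
    by_cases h : ∀ l, ¬bad (t l)
    · rw [hX t h, abs_zero]
      exact Finset.sum_nonneg fun j _ => by split_ifs <;> simp
    · push Not at h
      obtain ⟨j, hj⟩ := h
      refine (hX1 t).trans ?_
      refine le_trans ?_ (Finset.single_le_sum (f := fun j => if bad (t j) then (1 : ℝ) else 0)
        (fun j _ => by split_ifs <;> simp) (Finset.mem_univ j))
      simp [hj]
  refine (Finset.abs_sum_le_sum_abs _ _).trans ((Finset.sum_le_sum fun t _ => h1 t).trans ?_)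
  rw [Finset.sum_comm]
  simp only [prod_sum_with_factor ρ hρ1 (fun t => if bad t then (1 : ℝ) else 0)]
  simp only [mul_ite, mul_one, mul_zero, Finset.sum_const, Finset.card_univ, Fintype.card_fin,
    nsmul_eq_mul]
  exact mul_le_mul_of_nonneg_left hδ (Nat.cast_nonneg k)

/-- The difference of the values of two complexons at the sampled points. -/
def sampleDiff {n kU kW : ℕ} (A B : Complexon) (zU : Fin kU → unitInterval)
    (zW : Fin kW → unitInterval) (u : Fin n → Fin kU) (w : Fin n → Fin kW) {k : ℕ}
    (i : Fin k → Fin n) : ℝ :=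
  A k (fun l => zU (u (i l))) - B k (fun l => zW (w (i l)))

theorem abs_sub_le_one_of_mem {x y : ℝ} (hx : x ∈ Set.Icc (0 : ℝ) 1) (hy : y ∈ Set.Icc (0 : ℝ) 1) :
    |x - y| ≤ 1 := abs_le.2 ⟨by linarith [hx.1, hy.2], by linarith [hx.2, hy.1]⟩

/-- Two step complexons can be aligned along samples of the types, so that the cut distance
between them is controlled by the one between the samples. -/
theorem exists_aligning_map {n kU kW : ℕ} (hn : 0 < n) {A B : Complexon}
    {PU : Fin kU → Set unitInterval} {PW : Fin kW → Set unitInterval} (hPU : IsEquipartition PU)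
    (hPW : IsEquipartition PW) (hA : A.IsStepfunction PU) (hB : B.IsStepfunction PW)
    {zU : Fin kU → unitInterval} {zW : Fin kW → unitInterval} (hzU : ∀ a, zU a ∈ PU a)
    (hzW : ∀ b, zW b ∈ PW b) (u : Fin n → Fin kU) (w : Fin n → Fin kW) :
    ∃ (φ : unitInterval → unitInterval) (hφ : MeasurePreserving φ volume volume),
      ∀ (k : ℕ) (S : Fin k → Set unitInterval),
      ∃ f : Fin k → Fin n → ℝ, (∀ l i, f l i ∈ Set.Icc (0 : ℝ) 1) ∧
        |∫ x in Set.univ.pi S, (A k x - B.pullback φ hφ.measurable k x)|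
          ≤ k * typeDev u + k * typeDev w + k * (k - 1) / (2 * n)
            + ((n : ℝ) ^ k)⁻¹ * |∑ i : Fin k → Fin n with Function.Injective i,
                (∏ l, f l (i l)) * sampleDiff A B zU zW u w i| := by
  classical
  have hn' : (0 : ℝ) < n := by exact_mod_cast hn
  obtain ⟨cU, hcU0, hcUr, hcUc, hcUd⟩ := exists_type_coupling hn hPU.pos u
  obtain ⟨cW, hcW0, hcWr, hcWc, hcWd⟩ := exists_type_coupling hn hPW.pos w
  -- The two couplings are made conditionally independent given the index; the factor `n` normalises
  -- by its probability `1/n`.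
  set ρ : Fin n → Fin kU → Fin kW → ℝ := fun i a b => n * (cU i a * cW i b) with hρ
  have hρ0 : ∀ i a b, 0 ≤ ρ i a b := fun i a b =>
    mul_nonneg hn'.le (mul_nonneg (hcU0 i a) (hcW0 i b))
  have hρb : ∀ i a, ∑ b, ρ i a b = cU i a := by
    intro i a
    simp only [hρ, ← Finset.mul_sum, hcWr]
    field_simp
  have hρa : ∀ i b, ∑ a, ρ i a b = cW i b := by
    intro i b
    simp only [hρ, ← Finset.mul_sum, ← Finset.sum_mul, hcUr]
    field_simp
  obtain ⟨φ, ι, hφ, hι, hvol⟩ := exists_measurePreserving_of_joint hPU hPW ρ hρ0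
    (fun a => by simp only [hρb, hcUc])
    (fun b => by rw [Finset.sum_comm]; simp only [hρa, hcWc])
  refine ⟨φ, hφ, fun k S => ?_⟩
  set θ : unitInterval → Fin n × Fin kU × Fin kW := fun t =>
    (ι t, partIndex hPU t, partIndex hPW (φ t)) with hθ
  have hθpre : ∀ t, θ ⁻¹' {t} = ι ⁻¹' {t.1} ∩ PU t.2.1 ∩ φ ⁻¹' PW t.2.2 := by
    rintro ⟨i, a, b⟩
    ext s
    simp only [hθ, Set.mem_preimage, Set.mem_singleton_iff, Prod.mk.injEq, Set.mem_inter_iff,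
      mem_part_iff hPU, mem_part_iff hPW]
    tauto
  have hθm : ∀ t, MeasurableSet (θ ⁻¹' {t}) := fun t => by
    rw [hθpre]
    exact ((hι (measurableSet_singleton _)).inter (hPU.measurableSet _)).inter
      (hφ.measurable (hPW.measurableSet _))
  have hAB : ∀ x : Fin k → unitInterval, A k x - B.pullback φ hφ.measurable k x
      = (fun t : Fin k → Fin n × Fin kU × Fin kW =>
          A k (fun l => zU (t l).2.1) - B k (fun l => zW (t l).2.2)) fun l => θ (x l) := by
    intro x
    simp only [hθ, Complexon.pullback]
    congr 1
    · refine hA k _ _ fun l a => ?_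
      rw [mem_part_iff hPU, mem_part_iff hPU, (mem_part_iff hPU _ _).1 (hzU _)]
    · refine hB k _ _ fun l a => ?_
      rw [mem_part_iff hPW, mem_part_iff hPW, (mem_part_iff hPW _ _).1 (hzW _), Function.comp]
  set m : Fin k → Fin n × Fin kU × Fin kW → ℝ := fun l t => volume.real (S l ∩ θ ⁻¹' {t}) with hm
  have hmρ : ∀ l t, m l t ∈ Set.Icc 0 (ρ t.1 t.2.1 t.2.2) := fun l t =>
    ⟨measureReal_nonneg, by
      rw [← hvol, ← hθpre]
      exact measureReal_mono Set.inter_subset_right⟩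
  have hρsum : ∑ t : Fin n × Fin kU × Fin kW, ρ t.1 t.2.1 t.2.2 = 1 := by
    simp only [Fintype.sum_prod_type, hρb, hcUr]
    simp [hn'.ne']
  have hbadU : ∑ t : Fin n × Fin kU × Fin kW,
      (if t.2.1 ≠ u t.1 then ρ t.1 t.2.1 t.2.2 else 0) ≤ typeDev u := by
    refine le_trans (le_of_eq ?_) hcUd
    simp only [Fintype.sum_prod_type]
    refine Finset.sum_congr rfl fun i _ => Finset.sum_congr rfl fun a _ => ?_
    split_ifs
    · exact hρb i a
    · simp
  have hbadW : ∑ t : Fin n × Fin kU × Fin kW,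
      (if t.2.2 ≠ w t.1 then ρ t.1 t.2.1 t.2.2 else 0) ≤ typeDev w := by
    refine le_trans (le_of_eq ?_) hcWd
    simp only [Fintype.sum_prod_type]
    refine Finset.sum_congr rfl fun i _ => ?_
    rw [Finset.sum_comm]
    refine Finset.sum_congr rfl fun b _ => ?_
    split_ifs
    · exact hρa i b
    · simp
  have hstepU := sum_prod_mul_indicator_le (fun t : Fin n × Fin kU × Fin kW => ρ t.1 t.2.1 t.2.2)
    hρsum (fun t => t.2.1 ≠ u t.1) hbadU m hmρ
    (fun t => A k (fun l => zU (t l).2.1) - A k (fun l => zU (u (t l).1)))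
    (fun t => abs_sub_le_one_of_mem (A.mem_Icc' _ _) (A.mem_Icc' _ _))
    (fun t ht => by
      simp only [ne_eq, not_not] at ht
      simp only [ht, sub_self])
  have hstepW := sum_prod_mul_indicator_le (fun t : Fin n × Fin kU × Fin kW => ρ t.1 t.2.1 t.2.2)
    hρsum (fun t => t.2.2 ≠ w t.1) hbadW m hmρ
    (fun t => B k (fun l => zW (t l).2.2) - B k (fun l => zW (w (t l).1)))
    (fun t => abs_sub_le_one_of_mem (B.mem_Icc' _ _) (B.mem_Icc' _ _))
    (fun t ht => by
      simp only [ne_eq, not_not] at ht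
      simp only [ht, sub_self])
  have hιvol : ∀ i, volume.real (ι ⁻¹' {i}) = (n : ℝ)⁻¹ := by
    intro i
    have h1 : ι ⁻¹' {i} = ⋃ x : Fin kU × Fin kW, ι ⁻¹' {i} ∩ PU x.1 ∩ φ ⁻¹' PW x.2 := by
      ext s
      simp only [Set.mem_preimage, Set.mem_singleton_iff, Set.mem_iUnion, Set.mem_inter_iff,
        mem_part_iff hPU, mem_part_iff hPW, Prod.exists]
      exact ⟨fun h => ⟨_, _, ⟨h, rfl⟩, rfl⟩, fun ⟨_, _, ⟨h, _⟩, _⟩ => h⟩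
    rw [h1, measureReal_iUnion_fintype]
    · simp only [hvol, Fintype.sum_prod_type, hρb, hcUr]
    · rintro ⟨a, b⟩ ⟨a', b'⟩ hne
      rw [Function.onFun, Set.disjoint_left]
      rintro s ⟨⟨_, h1⟩, h2⟩ ⟨⟨_, h3⟩, h4⟩
      rw [Set.mem_preimage] at h2 h4
      rw [mem_part_iff hPU] at h1 h3
      rw [mem_part_iff hPW] at h2 h4
      exact hne (Prod.ext (h1.symm.trans h3) (h2.symm.trans h4))
    · exact fun x => ((hι (measurableSet_singleton _)).inter (hPU.measurableSet _)).inter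
        (hφ.measurable (hPW.measurableSet _))
  -- The fraction of the cell of index `i` that lies in the side `S l` of the box; it is the
  -- fractional weight of `i` at position `l`.
  set f : Fin k → Fin n → ℝ := fun l i => n * volume.real (S l ∩ ι ⁻¹' {i}) with hf
  have hf01 : ∀ l i, f l i ∈ Set.Icc (0 : ℝ) 1 := by
    intro l i
    refine ⟨mul_nonneg hn'.le measureReal_nonneg, ?_⟩
    have : volume.real (S l ∩ ι ⁻¹' {i}) ≤ (n : ℝ)⁻¹ := by
      rw [← hιvol i]
      exact measureReal_mono Set.inter_subset_right
    calc _ ≤ (n : ℝ) * (n : ℝ)⁻¹ := mul_le_mul_of_nonneg_left this hn'.le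
      _ = 1 := mul_inv_cancel₀ hn'.ne'
  have hmain : ∑ t : Fin k → Fin n × Fin kU × Fin kW,
      (∏ l, m l (t l)) * sampleDiff A B zU zW u w (fun l => (t l).1)
      = ((n : ℝ) ^ k)⁻¹ * ∑ i : Fin k → Fin n, (∏ l, f l (i l)) * sampleDiff A B zU zW u w i := by
    rw [← setIntegral_pi_comp S θ hθm fun t => sampleDiff A B zU zW u w (fun l => (t l).1),
      setIntegral_pi_comp S ι (fun i => hι (measurableSet_singleton i))
        fun i => sampleDiff A B zU zW u w i, Finset.mul_sum]
    refine Finset.sum_congr rfl fun i _ => ?_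
    simp only [hf, Finset.prod_mul_distrib, Finset.prod_const, Finset.card_univ, Fintype.card_fin]
    field_simp
  have hdiff : ∀ i : Fin k → Fin n, |(∏ l, f l (i l)) * sampleDiff A B zU zW u w i| ≤ 1 := by
    intro i
    rw [abs_mul]
    refine mul_le_one₀ ?_ (abs_nonneg _)
      (abs_sub_le_one_of_mem (A.mem_Icc' _ _) (B.mem_Icc' _ _))
    rw [abs_of_nonneg (Finset.prod_nonneg fun l _ => (hf01 l _).1)]
    exact Finset.prod_le_one (fun l _ => (hf01 l _).1) fun l _ => (hf01 l _).2
  have hnoninj : |∑ i : Fin k → Fin n with ¬Function.Injective i,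
      (∏ l, f l (i l)) * sampleDiff A B zU zW u w i| ≤ k * (k - 1) / (2 * n) * (n : ℝ) ^ k := by
    refine (Finset.abs_sum_le_sum_abs _ _).trans ((Finset.sum_le_sum fun i _ => hdiff i).trans ?_)
    rw [Finset.sum_const, nsmul_eq_mul, mul_one]
    have := card_not_injective_le n k
    rw [← mul_le_mul_iff_right₀ hn']
    refine this.trans (le_of_eq ?_)
    field_simp
  refine ⟨f, hf01, ?_⟩
  have hint : ∫ x in Set.univ.pi S, (A k x - B.pullback φ hφ.measurable k x)
      = ∑ t : Fin k → Fin n × Fin kU × Fin kW, (∏ l, m l (t l)) *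
        (A k (fun l => zU (t l).2.1) - B k (fun l => zW (t l).2.2)) :=
    (integral_congr_ae (.of_forall hAB)).trans (setIntegral_pi_comp S θ hθm
      fun t => A k (fun l => zU (t l).2.1) - B k (fun l => zW (t l).2.2))
  -- The true types are replaced by the sampled types, first in `A` and then in `B`; what remains
  -- depends on the indices only.
  have hdecomp : ∑ t : Fin k → Fin n × Fin kU × Fin kW, (∏ l, m l (t l)) *
      (A k (fun l => zU (t l).2.1) - B k (fun l => zW (t l).2.2))
      = ∑ t : Fin k → Fin n × Fin kU × Fin kW, (∏ l, m l (t l)) *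
          (A k (fun l => zU (t l).2.1) - A k (fun l => zU (u (t l).1)))
        - ∑ t : Fin k → Fin n × Fin kU × Fin kW, (∏ l, m l (t l)) *
          (B k (fun l => zW (t l).2.2) - B k (fun l => zW (w (t l).1)))
        + ∑ t : Fin k → Fin n × Fin kU × Fin kW,
          (∏ l, m l (t l)) * sampleDiff A B zU zW u w (fun l => (t l).1) := by
    rw [← Finset.sum_sub_distrib, ← Finset.sum_add_distrib]
    refine Finset.sum_congr rfl fun t _ => ?_
    simp only [sampleDiff]
    ring
  rw [hint, hdecomp, hmain, ← Finset.sum_filter_add_sum_filter_not Finset.univ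
    (fun i : Fin k → Fin n => Function.Injective i), mul_add]
  have hnk : (0 : ℝ) < (n : ℝ) ^ k := by positivity
  have h5 : |((n : ℝ) ^ k)⁻¹ * ∑ i : Fin k → Fin n with ¬Function.Injective i,
      (∏ l, f l (i l)) * sampleDiff A B zU zW u w i| ≤ k * (k - 1) / (2 * n) := by
    rw [abs_mul, abs_of_pos (inv_pos.2 hnk), inv_mul_eq_div, div_le_iff₀ hnk]
    exact hnoninj
  have h6 : |((n : ℝ) ^ k)⁻¹ * ∑ i : Fin k → Fin n with Function.Injective i,
      (∏ l, f l (i l)) * sampleDiff A B zU zW u w i|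
      = ((n : ℝ) ^ k)⁻¹ * |∑ i : Fin k → Fin n with Function.Injective i,
      (∏ l, f l (i l)) * sampleDiff A B zU zW u w i| := by
    rw [abs_mul, abs_of_pos (inv_pos.2 hnk)]
  rw [abs_le] at hstepU hstepW h5 ⊢
  have h7 := abs_le.1 h6.le
  constructor <;> linarith [hstepU.1, hstepU.2, hstepW.1, hstepW.2, h5.1, h5.2, h7.1, h7.2]

/-! ### Random complexes and their laws in terms of homomorphism densities. -/

/-- The sets of vertices that can be simplices of positive dimension at most `d`. -/
def possibleSimplices (n d : ℕ) : Finset (Finset (Fin n)) :=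
  Finset.univ.filter fun σ => 2 ≤ σ.card ∧ σ.card ≤ d + 1

/-- The simplices of the complex that is determined by coin tosses: those all of whose faces
are heads. -/
def coinSimplices {n : ℕ} (d : ℕ) (ω : Finset (Fin n) → Bool) : Finset (Finset (Fin n)) :=
  (possibleSimplices n d).filter fun σ => ∀ τ ∈ σ.powerset, 2 ≤ τ.card → ω τ = true

/-- The simplicial complex generated by a family of simplices. -/
def generatedComplex {n : ℕ} (G : Finset (Finset (Fin n))) : AbstractSimplicialComplex (Fin n) where
  faces := {σ | σ.Nonempty ∧ (σ.card = 1 ∨ ∃ ρ ∈ G, σ ⊆ ρ)}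
  isRelLowerSet_faces := fun σ hσ => ⟨hσ.1, fun τ hτσ hτ => by
    refine ⟨hτ, ?_⟩
    rcases hσ.2 with h | ⟨ρ, hρ, h⟩
    · exact Or.inl (le_antisymm (h ▸ Finset.card_le_card hτσ) (Finset.card_pos.2 hτ))
    · exact Or.inr ⟨ρ, hρ, hτσ.trans h⟩⟩
  singleton_mem v := ⟨Finset.singleton_nonempty v, Or.inl (Finset.card_singleton v)⟩

theorem mem_generatedComplex {n : ℕ} {G : Finset (Finset (Fin n))} {σ : Finset (Fin n)} :
    σ ∈ generatedComplex G ↔ σ.Nonempty ∧ (σ.card = 1 ∨ ∃ ρ ∈ G, σ ⊆ ρ) := Iff.rfl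

theorem isOfDimension_generatedComplex {n d : ℕ} {G : Finset (Finset (Fin n))}
    (hG : G ⊆ possibleSimplices n d) : IsOfDimension (generatedComplex G) d := by
  intro σ hσ
  rcases (mem_generatedComplex.1 hσ).2 with h | ⟨ρ, hρ, h⟩
  · omega
  · have := (Finset.mem_filter.1 (hG hρ)).2.2
    exact (Finset.card_le_card h).trans this

/-- Möbius inversion on the lattice of subsets of `S`: it recovers the event that the random family
equals `F` from the events that it contains `F ∪ T`. Only the `T ⊆ K \ F` contribute, and their
alternating sum vanishes unless `K \ F` is empty. -/
theorem sum_powerset_mobius {α : Type*} [DecidableEq α] {S F K : Finset α} (hK : K ⊆ S) :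
    ∑ T ∈ (S \ F).powerset, (-1 : ℝ) ^ T.card * (if F ∪ T ⊆ K then 1 else 0)
      = if K = F then 1 else 0 := by
  by_cases hFK : F ⊆ K
  · have h1 : (K \ F).powerset ⊆ (S \ F).powerset :=
      Finset.powerset_mono.2 (Finset.sdiff_subset_sdiff hK le_rfl)
    rw [← Finset.sum_subset h1]
    · have h2 : ∀ T ∈ (K \ F).powerset, (-1 : ℝ) ^ T.card * (if F ∪ T ⊆ K then 1 else 0)
          = ((-1 : ℤ) ^ T.card : ℤ) := by
        intro T hT
        rw [if_pos (Finset.union_subset hFK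
          ((Finset.mem_powerset.1 hT).trans Finset.sdiff_subset))]
        simp
      rw [Finset.sum_congr rfl h2, ← Int.cast_sum, Finset.sum_powerset_neg_one_pow_card]
      have h3 : K \ F = ∅ ↔ K = F :=
        ⟨fun h => Finset.Subset.antisymm (Finset.sdiff_eq_empty_iff_subset.1 h) hFK,
          fun h => by rw [h, Finset.sdiff_self]⟩
      simp only [h3]
      split_ifs <;> simp
    · intro T hT hT'
      rw [if_neg, mul_zero]
      intro h
      exact hT' (Finset.mem_powerset.2 fun x hx => Finset.mem_sdiff.2
        ⟨h (Finset.mem_union_right _ hx),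
          (Finset.mem_sdiff.1 (Finset.mem_powerset.1 hT hx)).2⟩)
  · rw [if_neg (fun h => hFK h.symm.subset)]
    refine Finset.sum_eq_zero fun T _ => ?_
    rw [if_neg fun h => hFK (Finset.subset_union_left.trans h), mul_zero]

/-- The expectation over uniform random types `u` and over the coins of the random simplicial
complex that is sampled from `U`; the points `z a` represent the types. -/
noncomputable def sampleExp {k : ℕ} (U : Complexon) (z : Fin k → unitInterval) (n : ℕ)
    (g : (Fin n → Fin k) → (Finset (Fin n) → Bool) → ℝ) : ℝ :=
  ((k : ℝ) ^ n)⁻¹ * ∑ u : Fin n → Fin k, coinExp (fun σ => U.face σ fun i => z (u i)) (g u)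

section SampleExp

variable {k n : ℕ} {U : Complexon} {z : Fin k → unitInterval}
  {g g' : (Fin n → Fin k) → (Finset (Fin n) → Bool) → ℝ}

theorem sampleExp_add : sampleExp U z n (fun u ω => g u ω + g' u ω)
    = sampleExp U z n g + sampleExp U z n g' := by
  simp only [sampleExp, coinExp_add, Finset.sum_add_distrib, mul_add]

theorem sampleExp_const_mul (c : ℝ) :
    sampleExp U z n (fun u ω => c * g u ω) = c * sampleExp U z n g := by
  simp only [sampleExp, coinExp_const_mul, ← Finset.mul_sum]
  ring

theorem sampleExp_sum {ι : Type*} (s : Finset ι)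
    (g : ι → (Fin n → Fin k) → (Finset (Fin n) → Bool) → ℝ) :
    sampleExp U z n (fun u ω => ∑ i ∈ s, g i u ω) = ∑ i ∈ s, sampleExp U z n (g i) := by
  simp only [sampleExp, coinExp_sum, Finset.mul_sum]
  exact Finset.sum_comm

theorem sampleExp_mono (h : ∀ u ω, g u ω ≤ g' u ω) :
    sampleExp U z n g ≤ sampleExp U z n g' :=
  mul_le_mul_of_nonneg_left (Finset.sum_le_sum fun u _ =>
    coinExp_mono (fun σ => U.face_mem_Icc σ _) (h u)) (by positivity)

theorem sampleExp_const (hk : 0 < k) (c : ℝ) : sampleExp U z n (fun _ _ => c) = c := by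
  simp only [sampleExp, coinExp_const, Finset.sum_const, Finset.card_univ, Fintype.card_fun,
    Fintype.card_fin, nsmul_eq_mul]
  push_cast
  field_simp

end SampleExp

section StepDensity

variable {k n : ℕ} {U : Complexon} {z : Fin k → unitInterval} {P : Fin k → Set unitInterval}

theorem face_eq_of_types (hP : IsEquipartition P) (hU : U.IsStepfunction P) (hz : ∀ a, z a ∈ P a)
    (σ : Finset (Fin n)) (x : Fin n → unitInterval) :
    U.face σ x = U.face σ fun i => z (partIndex hP (x i)) :=
  hU _ _ _ fun j a => by
    rw [mem_part_iff hP, mem_part_iff hP, (mem_part_iff hP _ _).1 (hz _)]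

open scoped Classical in
/-- The homomorphism density in a stepfunction as an average over the types. -/
theorem homDensity_eq_avg (hP : IsEquipartition P) (hU : U.IsStepfunction P)
    (hz : ∀ a, z a ∈ P a) (F : AbstractSimplicialComplex (Fin n)) :
    Complexon.homDensity F U = ((k : ℝ) ^ n)⁻¹ * ∑ u : Fin n → Fin k,
      ∏ σ ∈ Finset.univ.filter (fun σ : Finset (Fin n) => σ ∈ F),
        U.face σ fun i => z (u i) := by
  have h := setIntegral_pi_comp (fun _ : Fin n => Set.univ) (partIndex hP)
    (fun a => by rw [partIndex_preimage]; exact hP.measurableSet a)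
    (fun u => ∏ σ ∈ Finset.univ.filter (fun σ : Finset (Fin n) => σ ∈ F),
      U.face σ fun i => z (u i))
  rw [Set.pi_univ, Measure.restrict_univ] at h
  have h1 : ∀ x : Fin n → unitInterval,
      ∏ σ ∈ Finset.univ.filter (fun σ : Finset (Fin n) => σ ∈ F), U.face σ x
      = ∏ σ ∈ Finset.univ.filter (fun σ : Finset (Fin n) => σ ∈ F),
        U.face σ fun i => z (partIndex hP (x i)) := fun x =>
    Finset.prod_congr rfl fun σ _ => face_eq_of_types hP hU hz σ x
  refine ((integral_congr_ae (.of_forall h1)).trans h).trans ?_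
  rw [Finset.mul_sum]
  refine Finset.sum_congr rfl fun u _ => ?_
  simp only [Set.univ_inter, partIndex_preimage, hP.measureReal_part, Finset.prod_const,
    Finset.card_univ, Fintype.card_fin, inv_pow]

/-- The probability that the random complex contains given simplices is a homomorphism density. -/
theorem sampleExp_subset_coinSimplices (hP : IsEquipartition P) (hU : U.IsStepfunction P)
    (hz : ∀ a, z a ∈ P a) {d : ℕ} {G : Finset (Finset (Fin n))}
    (hG : G ⊆ possibleSimplices n d) :
    sampleExp U z n (fun _ ω => if G ⊆ coinSimplices d ω then 1 else 0)
      = Complexon.homDensity (generatedComplex G) U := by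
  classical
  rw [homDensity_eq_avg hP hU hz, sampleExp]
  congr 1
  refine Finset.sum_congr rfl fun u _ => ?_
  set C : Finset (Finset (Fin n)) := Finset.univ.filter fun τ => 2 ≤ τ.card ∧ ∃ ρ ∈ G, τ ⊆ ρ
  have h1 : (fun ω : Finset (Fin n) → Bool => if G ⊆ coinSimplices d ω then (1 : ℝ) else 0)
      = allHeads C := by
    funext ω
    rw [allHeads_eq_ite]
    congr 1
    simp only [eq_iff_iff, C, Finset.mem_filter, Finset.mem_univ, true_and]
    constructor
    · rintro h τ ⟨hτ, ρ, hρ, hτρ⟩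
      exact (Finset.mem_filter.1 (h hρ)).2 τ (Finset.mem_powerset.2 hτρ) hτ
    · intro h σ hσ
      exact Finset.mem_filter.2 ⟨hG hσ, fun τ hτ hτ2 =>
        h τ ⟨hτ2, σ, hσ, Finset.mem_powerset.1 hτ⟩⟩
  rw [h1, coinExp_allHeads]
  refine Finset.prod_subset ?_ ?_
  · intro τ hτ
    obtain ⟨hτ2, hτ⟩ := (Finset.mem_filter.1 hτ).2
    exact Finset.mem_filter.2 ⟨Finset.mem_univ _, mem_generatedComplex.2
      ⟨Finset.card_pos.1 (by omega), Or.inr hτ⟩⟩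
  · intro τ hτ hτC
    obtain ⟨_, hτ⟩ := mem_generatedComplex.1 (Finset.mem_filter.1 hτ).2
    -- The simplices of the generated complex that have no coin in `C` are single vertices, where
    -- `U` equals 1.
    refine U.eq_one' _ ?_ _
    by_contra hcard
    apply hτC
    refine Finset.mem_filter.2 ⟨Finset.mem_univ _, by omega, ?_⟩
    rcases hτ with h | h
    · omega
    · exact h

end StepDensity

/-- If the homomorphism densities in two stepfunctions are close, then so are the expectations of
functions of the random complexes. -/
theorem sampleExp_transfer {kU kW n d : ℕ} {U W : Complexon} {PU : Fin kU → Set unitInterval}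
    {PW : Fin kW → Set unitInterval} (hPU : IsEquipartition PU) (hPW : IsEquipartition PW)
    (hU : U.IsStepfunction PU) (hW : W.IsStepfunction PW) {zU : Fin kU → unitInterval}
    {zW : Fin kW → unitInterval} (hzU : ∀ a, zU a ∈ PU a) (hzW : ∀ b, zW b ∈ PW b) {ε B : ℝ}
    (hF : ∀ F : AbstractSimplicialComplex (Fin n), IsOfDimension F d →
      |Complexon.homDensity F U - Complexon.homDensity F W| ≤ ε)
    (g : Finset (Finset (Fin n)) → ℝ) (hg : ∀ F, |g F| ≤ B) :
    |sampleExp U zU n (fun _ ω => g (coinSimplices d ω))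
      - sampleExp W zW n (fun _ ω => g (coinSimplices d ω))|
      ≤ 4 ^ (possibleSimplices n d).card * (B * ε) := by
  classical
  set S := possibleSimplices n d with hS
  have hK : ∀ ω : Finset (Fin n) → Bool, coinSimplices d ω ⊆ S :=
    fun ω => Finset.filter_subset _ _
  have hB : 0 ≤ B := (abs_nonneg _).trans (hg ∅)
  have hε : 0 ≤ ε := (abs_nonneg _).trans
    (hF _ (isOfDimension_generatedComplex (Finset.empty_subset (possibleSimplices n d))))
  have hexp : ∀ ω : Finset (Fin n) → Bool, g (coinSimplices d ω)
      = ∑ F ∈ S.powerset, ∑ T ∈ (S \ F).powerset,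
        (g F * (-1 : ℝ) ^ T.card) * (if F ∪ T ⊆ coinSimplices d ω then 1 else 0) := by
    intro ω
    simp only [mul_assoc, ← Finset.mul_sum]
    rw [Finset.sum_congr rfl fun F _ => by rw [sum_powerset_mobius (F := F) (hK ω)]]
    simp [hK ω]
  have hval : ∀ (k : ℕ) (V : Complexon) (P : Fin k → Set unitInterval) (z : Fin k → unitInterval),
      IsEquipartition P → V.IsStepfunction P → (∀ a, z a ∈ P a) →
      sampleExp V z n (fun _ ω => g (coinSimplices d ω))
      = ∑ F ∈ S.powerset, ∑ T ∈ (S \ F).powerset,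
        (g F * (-1 : ℝ) ^ T.card) * Complexon.homDensity (generatedComplex (F ∪ T)) V := by
    intro k V P z hP hV hz
    simp only [hexp]
    rw [sampleExp_sum]
    refine Finset.sum_congr rfl fun F hF => ?_
    rw [sampleExp_sum]
    refine Finset.sum_congr rfl fun T hT => ?_
    rw [sampleExp_const_mul, sampleExp_subset_coinSimplices hP hV hz]
    exact Finset.union_subset (Finset.mem_powerset.1 hF)
      ((Finset.mem_powerset.1 hT).trans Finset.sdiff_subset)
  rw [hval kU U PU zU hPU hU hzU, hval kW W PW zW hPW hW hzW, ← Finset.sum_sub_distrib]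
  have hterm : ∀ F ∈ S.powerset, |∑ T ∈ (S \ F).powerset,
        (g F * (-1 : ℝ) ^ T.card) * Complexon.homDensity (generatedComplex (F ∪ T)) U
      - ∑ T ∈ (S \ F).powerset,
        (g F * (-1 : ℝ) ^ T.card) * Complexon.homDensity (generatedComplex (F ∪ T)) W|
      ≤ 2 ^ S.card * (B * ε) := by
    intro F hFS
    rw [← Finset.sum_sub_distrib]
    have h1 : ∀ T ∈ (S \ F).powerset,
        |(g F * (-1 : ℝ) ^ T.card) * Complexon.homDensity (generatedComplex (F ∪ T)) U
          - (g F * (-1 : ℝ) ^ T.card) * Complexon.homDensity (generatedComplex (F ∪ T)) W|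
        ≤ B * ε := by
      intro T hT
      rw [← mul_sub, abs_mul, abs_mul, abs_pow, abs_neg, abs_one, one_pow, mul_one]
      refine mul_le_mul (hg F) (hF _ (isOfDimension_generatedComplex ?_)) (abs_nonneg _) hB
      exact Finset.union_subset (Finset.mem_powerset.1 hFS)
        ((Finset.mem_powerset.1 hT).trans Finset.sdiff_subset)
    refine (Finset.abs_sum_le_sum_abs _ _).trans ((Finset.sum_le_sum h1).trans ?_)
    rw [Finset.sum_const, nsmul_eq_mul, Finset.card_powerset]
    push_cast
    refine mul_le_mul_of_nonneg_right ?_ (mul_nonneg hB hε)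
    exact pow_le_pow_right₀ one_le_two (Finset.card_le_card Finset.sdiff_subset)
  -- There are `2 ^ S.card` families `F`, each with at most `2 ^ S.card` sets `T`, whence the power
  -- of 4.
  refine (Finset.abs_sum_le_sum_abs _ _).trans ((Finset.sum_le_sum hterm).trans (le_of_eq ?_))
  rw [Finset.sum_const, nsmul_eq_mul, Finset.card_powerset]
  push_cast
  rw [← mul_assoc, ← mul_pow]
  norm_num

/-- Bound `n.choose r` by `n ^ r * (d + 1).choose r` for `r ≤ d + 1` and sum by the binomial
theorem. -/
theorem card_possibleSimplices_le (n d : ℕ) : (possibleSimplices n d).card ≤ (1 + n) ^ (d + 1) := by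
  have h1 : possibleSimplices n d
      ⊆ (Finset.range (d + 2)).biUnion fun r => Finset.powersetCard r Finset.univ := by
    intro σ hσ
    have := (Finset.mem_filter.1 hσ).2.2
    exact Finset.mem_biUnion.2 ⟨σ.card, Finset.mem_range.2 (by omega),
      Finset.mem_powersetCard.2 ⟨Finset.subset_univ _, rfl⟩⟩
  refine (Finset.card_le_card h1).trans (Finset.card_biUnion_le.trans ?_)
  rw [add_comm 1 n, add_pow]
  refine Finset.sum_le_sum fun r hr => ?_
  rw [Finset.card_powersetCard, Finset.card_univ, Fintype.card_fin, one_pow, mul_one]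
  refine (Nat.choose_le_pow n r).trans (Nat.le_mul_of_pos_right _ (Nat.choose_pos ?_))
  have := Finset.mem_range.1 hr
  omega

/-- The expected distance of the empirical distribution of the types from the uniform one. -/
theorem avg_typeDev_le {n k : ℕ} (hn : 0 < n) (hk : 0 < k) :
    ((k : ℝ) ^ n)⁻¹ * ∑ u : Fin n → Fin k, typeDev u ≤ Real.sqrt ((k - 1) / n) / 2 := by
  have hn' : (0 : ℝ) < n := by exact_mod_cast hn
  have hk' : (0 : ℝ) < k := by exact_mod_cast hk
  set y : Fin k → Fin k → ℝ := fun a b => (if b = a then 1 else 0) - (k : ℝ)⁻¹ with hy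
  have hy0 : ∀ a, ∑ b, y a b = 0 := by
    intro a
    simp [hy, hk'.ne']
  have hy2 : ∀ a, ∑ b, y a b ^ 2 = 1 - (k : ℝ)⁻¹ := by
    intro a
    have : ∀ b, y a b ^ 2 = (if b = a then 1 - 2 * (k : ℝ)⁻¹ else 0) + ((k : ℝ)⁻¹) ^ 2 := by
      intro b
      simp only [hy]
      split_ifs <;> ring
    simp only [this, Finset.sum_add_distrib]
    simp
    field_simp
    ring
  have hfreq : ∀ (u : Fin n → Fin k) a, typeFreq u a - (k : ℝ)⁻¹ = (n : ℝ)⁻¹ * ∑ i, y a (u i) := by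
    intro u a
    have h1 := sum_comp_type hn u fun b => y a b
    rw [Finset.mul_sum, h1]
    simp only [hy, mul_sub, Finset.sum_sub_distrib, ← Finset.sum_mul, sum_typeFreq hn u]
    simp
  have hoff : ∀ a (i j : Fin n), i ≠ j → ∑ u : Fin n → Fin k, y a (u i) * y a (u j) = 0 := by
    intro a i j hij
    have := sum_sum_update (fun u : Fin n → Fin k => y a (u i) * y a (u j)) i
    simp only [Function.update_self, Function.update_of_ne hij.symm, ← Finset.sum_mul, hy0,
      zero_mul, Finset.sum_const_zero, Fintype.card_fin] at this
    exact (mul_eq_zero.1 this.symm).resolve_left hk'.ne'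
  have hdiag : ∀ a (i : Fin n), ∑ u : Fin n → Fin k, y a (u i) * y a (u i)
      = (k : ℝ) ^ n * ((k : ℝ)⁻¹ * (1 - (k : ℝ)⁻¹)) := by
    intro a i
    have := sum_sum_update (fun u : Fin n → Fin k => y a (u i) * y a (u i)) i
    simp only [Function.update_self, ← pow_two, hy2, Fintype.card_fin, Finset.sum_const,
      Finset.card_univ, Fintype.card_fun, nsmul_eq_mul] at this ⊢
    push_cast at this
    field_simp at this ⊢
    linarith
  have hsq : ∀ a, ∑ u : Fin n → Fin k, (typeFreq u a - (k : ℝ)⁻¹) ^ 2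
      = (k : ℝ) ^ n * ((k : ℝ)⁻¹ * (1 - (k : ℝ)⁻¹) / n) := by
    intro a
    simp only [hfreq, mul_pow, pow_two (∑ i, y a _)]
    rw [← Finset.mul_sum]
    simp only [Finset.sum_mul_sum]
    rw [Finset.sum_comm, Finset.sum_congr rfl fun i _ => Finset.sum_comm]
    have : ∀ i : Fin n, ∑ j, ∑ u : Fin n → Fin k, y a (u i) * y a (u j)
        = (k : ℝ) ^ n * ((k : ℝ)⁻¹ * (1 - (k : ℝ)⁻¹)) := by
      intro i
      rw [Finset.sum_eq_single i (fun j _ hj => hoff a i j hj.symm) (by simp), hdiag]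
    simp only [this, Finset.sum_const, Finset.card_univ, Fintype.card_fin, nsmul_eq_mul]
    field_simp
  have htot : ∑ u : Fin n → Fin k, ∑ a, (typeFreq u a - (k : ℝ)⁻¹) ^ 2
      = (k : ℝ) ^ n * ((1 - (k : ℝ)⁻¹) / n) := by
    rw [Finset.sum_comm, Finset.sum_congr rfl fun a _ => hsq a]
    simp
    field_simp
  -- Cauchy–Schwarz over types and samples together; the total variance `(1 - 1/k) / n` times the
  -- number `k` of types gives `(k - 1) / n`.
  have hcs : (∑ x : (Fin n → Fin k) × Fin k, |typeFreq x.1 x.2 - (k : ℝ)⁻¹|) ^ 2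
      ≤ ((k : ℝ) ^ n * k) * ((k : ℝ) ^ n * ((1 - (k : ℝ)⁻¹) / n)) := by
    have := sq_sum_le_card_mul_sum_sq (s := Finset.univ)
      (f := fun x : (Fin n → Fin k) × Fin k => |typeFreq x.1 x.2 - (k : ℝ)⁻¹|)
    simp only [sq_abs] at this
    rw [Fintype.sum_prod_type (f := fun x : (Fin n → Fin k) × Fin k =>
      (typeFreq x.1 x.2 - (k : ℝ)⁻¹) ^ 2), htot] at this
    simpa using this
  have h1 : ((k : ℝ) ^ n)⁻¹ * ∑ u : Fin n → Fin k, typeDev u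
      = (((k : ℝ) ^ n)⁻¹ * ∑ x : (Fin n → Fin k) × Fin k, |typeFreq x.1 x.2 - (k : ℝ)⁻¹|) / 2 := by
    rw [Fintype.sum_prod_type]
    simp only [typeDev, ← Finset.sum_div]
    ring
  rw [h1]
  refine div_le_div_of_nonneg_right (Real.le_sqrt_of_sq_le ?_) zero_le_two
  rw [mul_pow]
  refine (mul_le_mul_of_nonneg_left hcs (by positivity)).trans (le_of_eq ?_)
  field_simp

/-! ### Bounds on the cut distance by the costs of samples. -/

theorem abs_setIntegral_complexon_sub_le_one (A B : Complexon) {k : ℕ}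
    (S : Fin k → Set unitInterval) : |∫ x in Set.univ.pi S, (A k x - B k x)| ≤ 1 := by
  have h := norm_setIntegral_le_of_norm_le_const (μ := volume) (s := Set.univ.pi S)
    (f := fun x => A k x - B k x) (C := 1) (measure_lt_top _ _)
    (fun x _ => abs_sub_le_one_of_mem (A.mem_Icc' k x) (B.mem_Icc' k x))
  rw [Real.norm_eq_abs, one_mul] at h
  exact h.trans measureReal_le_one

theorem cutDistDim_nonneg (d : ℕ) (A B : Complexon) : 0 ≤ Complexon.cutDistDim d A B :=
  Real.iSup_nonneg fun _ => abs_nonneg _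

/-- A single map bounds the infimum, as the labeled distances are bounded below by 0. Since `α`
vanishes beyond `d`, the series is a finite sum. -/
theorem cutDist_le {A B : Complexon} {α c : ℕ → ℝ} {d : ℕ} (hα : ∀ j, 0 ≤ α j)
    (hαd : ∀ j, d < j → α j = 0) {φ : unitInterval → unitInterval}
    (hφ : MeasurePreserving φ volume volume)
    (hc : ∀ j ∈ Finset.Icc 1 d, ∀ S : Fin (j + 1) → Set unitInterval,
      |∫ x in Set.univ.pi S, (A (j + 1) x - B.pullback φ hφ.measurable (j + 1) x)| ≤ c j) :
    Complexon.cutDist α A B ≤ ∑ j ∈ Finset.Icc 1 d, α j * c j := by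
  have hbdd : BddBelow (Set.range fun φ : {φ : unitInterval → unitInterval //
      MeasurePreserving φ volume volume} =>
      Complexon.labeledCutDist α A (B.pullback φ.1 φ.2.measurable)) :=
    ⟨0, by
      rintro _ ⟨ψ, rfl⟩
      exact tsum_nonneg fun j => mul_nonneg (hα _) (cutDistDim_nonneg _ _ _)⟩
  refine (ciInf_le hbdd ⟨φ, hφ⟩).trans ?_
  have hIcc : Finset.Icc 1 d = Finset.Ico 1 (d + 1) := by
    ext j
    simp only [Finset.mem_Icc, Finset.mem_Ico]
    omega
  unfold Complexon.labeledCutDist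
  rw [tsum_eq_sum (s := Finset.range d), hIcc, Finset.sum_Ico_eq_sum_range]
  · rw [Nat.add_sub_cancel]
    refine Finset.sum_le_sum fun j hj => ?_
    rw [add_comm 1 j]
    refine mul_le_mul_of_nonneg_left ?_ (hα _)
    have hj' : j + 1 ∈ Finset.Icc 1 d :=
      Finset.mem_Icc.2 ⟨by omega, Finset.mem_range.1 hj⟩
    have : Nonempty (Fin (j + 1 + 1) → {s : Set unitInterval // MeasurableSet s}) :=
      ⟨fun _ => ⟨∅, MeasurableSet.empty⟩⟩
    exact ciSup_le fun S => hc (j + 1) hj' fun l => (S l : Set unitInterval)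
  · intro j hj
    rw [hαd (j + 1) (by simpa [Nat.lt_succ_iff] using hj), zero_mul]

/-- This identifies the faceted complexon at sampled points with the probability that all coins of
the tuple are heads; faces with at most one position contribute 1. -/
theorem faceted_eq_prod_allCoins (U : Complexon) {n k : ℕ} {i : Fin k → Fin n}
    (hi : Function.Injective i) (x : Fin n → unitInterval) :
    U.faceted k (fun l => x (i l)) = ∏ A ∈ allCoins i, U.face A x := by
  have hface : ∀ B : Finset (Fin k), U.face B (fun l => x (i l)) = U.face (B.image i) x := by
    intro B
    rw [U.face_eq (B.image i) (fun j => i (B.orderEmbOfFin rfl j))]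
    · rfl
    · exact hi.comp (B.orderEmbOfFin rfl).injective
    · have h : Finset.univ.image (fun j => B.orderEmbOfFin rfl j) = B := by
        apply Finset.coe_injective
        simp
      calc Finset.univ.image (fun j => i (B.orderEmbOfFin rfl j))
          = (Finset.univ.image fun j => B.orderEmbOfFin rfl j).image i := by
            rw [Finset.image_image]; rfl
        _ = B.image i := by rw [h]
  rw [allCoins, Finset.prod_image (Finset.image_injective hi).injOn]
  simp only [← hface]
  symm
  apply Finset.prod_subset (Finset.subset_univ _)
  intro B _ hB
  refine U.eq_one' _ ?_ _
  simp only [Finset.mem_filter, Finset.mem_univ, true_and] at hB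
  omega

theorem image_mem_coinSimplices {n k d : ℕ} {i : Fin k → Fin n} (hi : Function.Injective i)
    (hk : 2 ≤ k) (hkd : k ≤ d + 1) (ω : Finset (Fin n) → Bool) :
    (if Finset.univ.image i ∈ coinSimplices d ω then (1 : ℝ) else 0)
      = allHeads (allCoins i) ω := by
  have hcard : (Finset.univ.image i).card = k := by
    rw [Finset.card_image_of_injective _ hi, Finset.card_univ, Fintype.card_fin]
  rw [allHeads_eq_ite]
  congr 1
  simp only [eq_iff_iff, coinSimplices, possibleSimplices, Finset.mem_filter, Finset.mem_univ,
    true_and, hcard, allCoins, Finset.mem_image, Finset.mem_powerset]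
  constructor
  · rintro ⟨-, h⟩ _ ⟨B, hB, rfl⟩
    exact h _ (Finset.image_subset_image (Finset.subset_univ _))
      (by rwa [Finset.card_image_of_injective _ hi])
  · intro h
    refine ⟨⟨hk, hkd⟩, fun τ hτ hτ2 => ?_⟩
    obtain ⟨B, -, rfl⟩ := Finset.subset_image_iff.1 hτ
    exact h _ ⟨B, by rwa [Finset.card_image_of_injective _ hi] at hτ2, rfl⟩

/-- The difference in a box between the indicator of a family of simplices and a complexon on
sampled points. -/
def simplexDiff {n k : ℕ} (A : Complexon) (y : Fin n → unitInterval) (F : Finset (Finset (Fin n)))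
    (f : Fin k → Fin n → ℝ) : ℝ :=
  ∑ i : Fin k → Fin n with Function.Injective i, (∏ l, f l (i l)) *
    ((if Finset.univ.image i ∈ F then 1 else 0) - A k fun l => y (i l))

/-- The cut distance in dimension `k - 1` between a family of simplices and a complexon on sampled
points. -/
noncomputable def simplexDist {n : ℕ} (A : Complexon) (y : Fin n → unitInterval)
    (F : Finset (Finset (Fin n))) (k : ℕ) : ℝ :=
  ⨆ f : Fin k → Fin n → unitInterval, |simplexDiff A y F fun l i => (f l i : ℝ)|

section SimplexDist

variable {n k : ℕ} (A : Complexon) (y : Fin n → unitInterval) (F : Finset (Finset (Fin n)))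

theorem abs_simplexDiff_le {f : Fin k → Fin n → ℝ} (hf : ∀ l i, f l i ∈ Set.Icc (0 : ℝ) 1) :
    |simplexDiff A y F f| ≤ (n : ℝ) ^ k := by
  have h1 : ∀ i : Fin k → Fin n, |(∏ l, f l (i l)) *
      ((if Finset.univ.image i ∈ F then 1 else 0) - A k fun l => y (i l))| ≤ 1 := by
    intro i
    rw [abs_mul]
    refine mul_le_one₀ ?_ (abs_nonneg _)
      (abs_sub_le_one_of_mem (by split_ifs <;> simp) (A.mem_Icc' _ _))
    rw [abs_of_nonneg (Finset.prod_nonneg fun l _ => (hf l _).1)]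
    exact Finset.prod_le_one (fun l _ => (hf l _).1) fun l _ => (hf l _).2
  refine (Finset.abs_sum_le_sum_abs _ _).trans ((Finset.sum_le_sum fun i _ => h1 i).trans ?_)
  rw [Finset.sum_const, nsmul_eq_mul, mul_one]
  have : (Finset.univ.filter fun i : Fin k → Fin n => Function.Injective i).card ≤ n ^ k := by
    refine (Finset.card_le_univ _).trans (by simp)
  exact_mod_cast this

theorem abs_simplexDiff_le_simplexDist {f : Fin k → Fin n → ℝ}
    (hf : ∀ l i, f l i ∈ Set.Icc (0 : ℝ) 1) : |simplexDiff A y F f| ≤ simplexDist A y F k :=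
  le_ciSup (f := fun f : Fin k → Fin n → unitInterval => |simplexDiff A y F fun l i => (f l i : ℝ)|)
    ⟨(n : ℝ) ^ k, by
      rintro _ ⟨g, rfl⟩
      exact abs_simplexDiff_le A y F fun l i => (g l i).2⟩ fun l i => ⟨f l i, hf l i⟩

theorem simplexDist_le {c : ℝ} (hc : ∀ f : Fin k → Fin n → ℝ,
    (∀ l i, f l i ∈ Set.Icc (0 : ℝ) 1) → |simplexDiff A y F f| ≤ c) : simplexDist A y F k ≤ c :=
  ciSup_le fun f => hc _ fun l i => (f l i).2

theorem simplexDist_nonneg : 0 ≤ simplexDist A y F k :=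
  Real.iSup_nonneg fun _ => abs_nonneg _

end SimplexDist

/-- The supremum over the weights is inside the expectation, so a majorant valid for all weights at
once is needed; it is applied for each choice of types separately. -/
theorem sampleExp_simplexDist_le {kU n d k : ℕ} (hn : 0 < n) (hkU : 0 < kU) (U : Complexon)
    (z : Fin kU → unitInterval) (hk : 2 ≤ k) (hkd : k ≤ d + 1) {c : ℝ} (hc0 : 0 < c)
    (hc : c ≤ 2 / 5) :
    sampleExp U z n (fun u ω => simplexDist U.faceted (fun i => z (u i)) (coinSimplices d ω) k)
      ≤ (n : ℝ) ^ k * (k * (k - 1) * ((2 * n + 1) * Real.log 2) / (c * n ^ 2) + 3 / 5 * c) := by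
  have hex := fun u : Fin n → Fin kU => exists_majorant_tuples hn
    (p := fun σ => U.face σ fun i => z (u i)) (fun σ => U.face_mem_Icc σ _) k hc0 hc
  choose M hM hE using hex
  set b := (n : ℝ) ^ k * (k * (k - 1) * ((2 * n + 1) * Real.log 2) / (c * n ^ 2) + 3 / 5 * c)
  have h1 : ∀ u ω, simplexDist U.faceted (fun i => z (u i)) (coinSimplices d ω) k ≤ M u ω := by
    intro u ω
    refine simplexDist_le _ _ _ fun f hf => le_trans (le_of_eq ?_) (hM u ω f hf)
    unfold simplexDiff
    congr 1
    refine Finset.sum_congr rfl fun i hi => ?_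
    have hi := (Finset.mem_filter.1 hi).2
    rw [image_mem_coinSimplices hi hk hkd]
    congr 2
    exact faceted_eq_prod_allCoins U hi fun i => z (u i)
  refine (sampleExp_mono h1).trans ?_
  have h2 : ∑ u : Fin n → Fin kU, coinExp (fun σ => U.face σ fun i => z (u i)) (M u)
      ≤ (kU : ℝ) ^ n * b := by
    refine (Finset.sum_le_sum fun u _ => hE u).trans (le_of_eq ?_)
    simp
  rw [sampleExp, inv_mul_eq_div, div_le_iff₀ (by positivity), mul_comm b]
  exact h2

theorem typeDev_le_one {n k : ℕ} (hn : 0 < n) (hk : 0 < k) (u : Fin n → Fin k) :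
    typeDev u ≤ 1 := by
  have h1 : ∑ a, |typeFreq u a - (k : ℝ)⁻¹| ≤ ∑ a, (typeFreq u a + (k : ℝ)⁻¹) := by
    refine Finset.sum_le_sum fun a _ => ?_
    have h2 := typeFreq_nonneg u a
    have h3 : 0 ≤ (k : ℝ)⁻¹ := by positivity
    exact abs_le.2 ⟨by linarith, by linarith⟩
  have hk' : (k : ℝ) ≠ 0 := by exact_mod_cast hk.ne'
  rw [Finset.sum_add_distrib, sum_typeFreq hn u] at h1
  simp [hk'] at h1
  unfold typeDev
  linarith

/-- A bound for the distance between a complexon and a family of simplices along a sample. -/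
noncomputable def sampleCost {kU n : ℕ} (A : Complexon) (z : Fin kU → unitInterval) (α : ℕ → ℝ)
    (d : ℕ) (u : Fin n → Fin kU) (F : Finset (Finset (Fin n))) : ℝ :=
  ∑ j ∈ Finset.Icc 1 d, α j * (((j : ℝ) + 1) * typeDev u
    + ((n : ℝ) ^ (j + 1))⁻¹ * simplexDist A (fun i => z (u i)) F (j + 1))

section SampleCost

variable {kU n d : ℕ} {α : ℕ → ℝ}

theorem sampleCost_nonneg (hα : ∀ j, 0 ≤ α j) (A : Complexon) (z : Fin kU → unitInterval)
    (u : Fin n → Fin kU) (F : Finset (Finset (Fin n))) : 0 ≤ sampleCost A z α d u F :=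
  Finset.sum_nonneg fun j _ => mul_nonneg (hα j) (add_nonneg
    (mul_nonneg (by positivity) (typeDev_nonneg u))
    (mul_nonneg (by positivity) (simplexDist_nonneg _ _ _)))

/-- The uniform bound that the transfer between the two laws requires: each `j` contributes at most
`(j + 1) + 1`. -/
theorem sampleCost_le (hα : ∀ j, 0 ≤ α j) (hn : 0 < n) (hkU : 0 < kU) (A : Complexon)
    (z : Fin kU → unitInterval) (u : Fin n → Fin kU) (F : Finset (Finset (Fin n))) :
    sampleCost A z α d u F ≤ (d + 2) * ∑ j ∈ Finset.Icc 1 d, α j := by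
  rw [Finset.mul_sum]
  refine Finset.sum_le_sum fun j hj => ?_
  rw [mul_comm]
  refine mul_le_mul_of_nonneg_right ?_ (hα j)
  have hjd : (j : ℝ) ≤ d := by exact_mod_cast (Finset.mem_Icc.1 hj).2
  have h1 : ((j : ℝ) + 1) * typeDev u ≤ d + 1 := by
    nlinarith [typeDev_le_one hn hkU u, typeDev_nonneg u, (Nat.cast_nonneg j : (0 : ℝ) ≤ j)]
  have hnk : (0 : ℝ) < (n : ℝ) ^ (j + 1) := by positivity
  have h2 : ((n : ℝ) ^ (j + 1))⁻¹ * simplexDist A (fun i => z (u i)) F (j + 1) ≤ 1 := by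
    rw [inv_mul_eq_div, div_le_one hnk]
    exact simplexDist_le _ _ _ fun f hf => abs_simplexDiff_le _ _ _ hf
  linarith

theorem sampleExp_sampleCost_le (hα : ∀ j, 0 ≤ α j) (hn : 0 < n) (hkU : 0 < kU) (U : Complexon)
    (z : Fin kU → unitInterval) {c : ℕ → ℝ} (hc0 : ∀ j ∈ Finset.Icc 1 d, 0 < c j)
    (hc : ∀ j ∈ Finset.Icc 1 d, c j ≤ 2 / 5) :
    sampleExp U z n (fun u ω => sampleCost U.faceted z α d u (coinSimplices d ω))
      ≤ ∑ j ∈ Finset.Icc 1 d, α j * ((j + 1) * (Real.sqrt ((kU - 1) / n) / 2)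
        + ((j + 1) * j * ((2 * n + 1) * Real.log 2) / (c j * n ^ 2) + 3 / 5 * c j)) := by
  unfold sampleCost
  rw [sampleExp_sum]
  refine Finset.sum_le_sum fun j hj => ?_
  rw [sampleExp_const_mul, sampleExp_add, sampleExp_const_mul, sampleExp_const_mul]
  refine mul_le_mul_of_nonneg_left (add_le_add (mul_le_mul_of_nonneg_left ?_ (by positivity)) ?_)
    (hα j)
  · simp only [sampleExp, coinExp_const]
    exact avg_typeDev_le hn hkU
  · have hj' := Finset.mem_Icc.1 hj
    have h := sampleExp_simplexDist_le (d := d) (k := j + 1) hn hkU U z (by omega) (by omega)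
      (hc0 j hj) (hc j hj)
    have hnk : (0 : ℝ) < (n : ℝ) ^ (j + 1) := by positivity
    rw [inv_mul_eq_div, div_le_iff₀ hnk, mul_comm _ ((n : ℝ) ^ (j + 1))]
    refine h.trans (le_of_eq ?_)
    push_cast
    ring

end SampleCost

/-- The unlabeled cut distance between two stepfunctions is controlled by the costs of two
samples with the same family of simplices. -/
theorem cutDist_le_sampleCost {kU kW n d : ℕ} (hn : 0 < n) {A B : Complexon}
    {PU : Fin kU → Set unitInterval} {PW : Fin kW → Set unitInterval} (hPU : IsEquipartition PU)
    (hPW : IsEquipartition PW) (hA : A.IsStepfunction PU) (hB : B.IsStepfunction PW)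
    {zU : Fin kU → unitInterval} {zW : Fin kW → unitInterval} (hzU : ∀ a, zU a ∈ PU a)
    (hzW : ∀ b, zW b ∈ PW b) {α : ℕ → ℝ} (hα : ∀ j, 0 ≤ α j) (hαd : ∀ j, d < j → α j = 0)
    (u : Fin n → Fin kU) (w : Fin n → Fin kW) (F : Finset (Finset (Fin n))) :
    Complexon.cutDist α A B ≤ sampleCost A zU α d u F + sampleCost B zW α d w F
      + ∑ j ∈ Finset.Icc 1 d, α j * ((j + 1) * j / (2 * n)) := by
  obtain ⟨φ, hφ, hint⟩ := exists_aligning_map hn hPU hPW hA hB hzU hzW u w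
  refine (cutDist_le hα hαd hφ (c := fun j =>
    (((j : ℝ) + 1) * typeDev u
      + ((n : ℝ) ^ (j + 1))⁻¹ * simplexDist A (fun i => zU (u i)) F (j + 1))
    + (((j : ℝ) + 1) * typeDev w
      + ((n : ℝ) ^ (j + 1))⁻¹ * simplexDist B (fun i => zW (w i)) F (j + 1))
    + (j + 1) * j / (2 * n)) fun j _ S => ?_).trans (le_of_eq ?_)
  · obtain ⟨f, hf, hle⟩ := hint (j + 1) S
    have h1 : ∑ i : Fin (j + 1) → Fin n with Function.Injective i,
        (∏ l, f l (i l)) * sampleDiff A B zU zW u w i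
        = simplexDiff B (fun i => zW (w i)) F f - simplexDiff A (fun i => zU (u i)) F f := by
      unfold simplexDiff sampleDiff
      rw [← Finset.sum_sub_distrib]
      exact Finset.sum_congr rfl fun i _ => by ring
    have h2 : |simplexDiff B (fun i => zW (w i)) F f - simplexDiff A (fun i => zU (u i)) F f|
        ≤ simplexDist B (fun i => zW (w i)) F (j + 1)
          + simplexDist A (fun i => zU (u i)) F (j + 1) :=
      (abs_sub _ _).trans (add_le_add (abs_simplexDiff_le_simplexDist _ _ _ hf)
        (abs_simplexDiff_le_simplexDist _ _ _ hf))
    rw [h1] at hle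
    refine hle.trans ?_
    have h3 := mul_le_mul_of_nonneg_left h2
      (by positivity : 0 ≤ ((n : ℝ) ^ (j + 1))⁻¹)
    push_cast
    rw [add_sub_cancel_right]
    linarith
  · unfold sampleCost
    rw [← Finset.sum_add_distrib, ← Finset.sum_add_distrib]
    exact Finset.sum_congr rfl fun j _ => by ring

/-- Closeness of the homomorphism densities yields a common sample of small total cost. -/
theorem exists_common_sample {kU kW n d : ℕ} {U W : Complexon} {PU : Fin kU → Set unitInterval}
    {PW : Fin kW → Set unitInterval} (hPU : IsEquipartition PU) (hPW : IsEquipartition PW)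
    (hU : U.IsStepfunction PU) (hW : W.IsStepfunction PW) {zU : Fin kU → unitInterval}
    {zW : Fin kW → unitInterval} (hzU : ∀ a, zU a ∈ PU a) (hzW : ∀ b, zW b ∈ PW b) {ε B : ℝ}
    (hF : ∀ F : AbstractSimplicialComplex (Fin n), IsOfDimension F d →
      |Complexon.homDensity F U - Complexon.homDensity F W| ≤ ε)
    (ΦU : (Fin n → Fin kU) → Finset (Finset (Fin n)) → ℝ)
    (ΦW : (Fin n → Fin kW) → Finset (Finset (Fin n)) → ℝ)
    (hΦ0 : ∀ w F, 0 ≤ ΦW w F) (hΦB : ∀ w F, ΦW w F ≤ B) :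
    ∃ u w F, ΦU u F + ΦW w F ≤ sampleExp U zU n (fun u ω => ΦU u (coinSimplices d ω))
      + sampleExp W zW n (fun w ω => ΦW w (coinSimplices d ω))
      + 4 ^ (possibleSimplices n d).card * (B * ε) := by
  have : Nonempty (Fin kU) := ⟨⟨0, hPU.pos⟩⟩
  have : Nonempty (Fin kW) := ⟨⟨0, hPW.pos⟩⟩
  have hu := fun F => Finite.exists_min fun u => ΦU u F
  have hw := fun F => Finite.exists_min fun w => ΦW w F
  choose uF hu using hu
  choose wF hw using hw
  -- With the best types chosen for each `F`, both costs are functions of the complex alone. The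
  -- minimum over `F` is at most the expectation over the sample from `U`; the part belonging to `W`
  -- is then moved to the sample from `W`.
  obtain ⟨F, hFmin⟩ := Finite.exists_min fun F => ΦU (uF F) F + ΦW (wF F) F
  refine ⟨uF F, wF F, F, ?_⟩
  have h1 : ΦU (uF F) F + ΦW (wF F) F ≤ sampleExp U zU n (fun _ ω =>
      ΦU (uF (coinSimplices d ω)) (coinSimplices d ω)
        + ΦW (wF (coinSimplices d ω)) (coinSimplices d ω)) := by
    rw [← sampleExp_const (U := U) (z := zU) (n := n) hPU.pos (ΦU (uF F) F + ΦW (wF F) F)]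
    exact sampleExp_mono fun u ω => hFmin _
  rw [sampleExp_add] at h1
  have h2 : sampleExp U zU n (fun _ ω => ΦU (uF (coinSimplices d ω)) (coinSimplices d ω))
      ≤ sampleExp U zU n (fun u ω => ΦU u (coinSimplices d ω)) :=
    sampleExp_mono fun u ω => hu _ u
  have h3 : sampleExp W zW n (fun _ ω => ΦW (wF (coinSimplices d ω)) (coinSimplices d ω))
      ≤ sampleExp W zW n (fun w ω => ΦW w (coinSimplices d ω)) :=
    sampleExp_mono fun w ω => hw _ w
  have h4 := sampleExp_transfer hPU hPW hU hW hzU hzW hF (fun F => ΦW (wF F) F) (B := B)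
    fun F => abs_le.2 ⟨by linarith [hΦ0 (wF F) F, hΦB (wF F) F], hΦB _ _⟩
  linarith [(abs_le.1 h4).2]

/-! ### Numerical estimates. -/

/-- The error made by comparing the laws of the random complexes. -/
theorem transfer_error_le {n d : ℕ} (hn : 3 ≤ n) (hdn : d + 2 ≤ n) :
    (4 : ℝ) ^ (possibleSimplices n d).card * ((d + 2) * (0.999 * ((2 : ℝ) ^ ((1 + n) ^ (d + 2)))⁻¹))
      ≤ (Real.sqrt n)⁻¹ := by
  have hn' : (0 : ℝ) < n := by exact_mod_cast (by omega : 0 < n)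
  have hs : 0 < Real.sqrt n := Real.sqrt_pos.2 hn'
  -- Of the `n + 1` copies of `(1 + n) ^ (d + 1)` in the exponent, two absorb the power of 4; the
  -- others provide `2 ^ (2 * n)`, which absorbs `(d + 2) * √n`.
  have hexp : 2 * (possibleSimplices n d).card + 2 * n ≤ (1 + n) ^ (d + 2) := by
    have h1 := card_possibleSimplices_le n d
    have h2 : 2 * n ≤ (n - 1) * (1 + n) ^ (d + 1) := by
      have h3 : 2 * n ≤ (n - 1) * (1 + n) := by
        obtain ⟨m, rfl⟩ : ∃ m, n = m + 3 := ⟨n - 3, by omega⟩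
        rw [show m + 3 - 1 = m + 2 by omega]
        nlinarith
      exact h3.trans (Nat.mul_le_mul_left _ (Nat.le_self_pow (by omega) _))
    have h5 : (1 + n) ^ (d + 2) = 2 * (1 + n) ^ (d + 1) + (n - 1) * (1 + n) ^ (d + 1) := by
      rw [← add_mul, pow_succ, mul_comm]
      congr 1
      omega
    omega
  have h4 : (4 : ℝ) ^ (possibleSimplices n d).card = 2 ^ (2 * (possibleSimplices n d).card) := by
    rw [pow_mul]; norm_num
  have h6 : (2 : ℝ) ^ (2 * (possibleSimplices n d).card) * 2 ^ (2 * n)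
      ≤ 2 ^ ((1 + n) ^ (d + 2)) := by
    rw [← pow_add]
    exact pow_le_pow_right₀ one_le_two hexp
  have h7 : ((d : ℝ) + 2) * Real.sqrt n ≤ 2 ^ (2 * n) := by
    have h8 : (n : ℝ) ≤ 2 ^ n := by exact_mod_cast (Nat.lt_two_pow_self (n := n)).le
    have h9 : (d : ℝ) + 2 ≤ n := by exact_mod_cast hdn
    have h10 : Real.sqrt n ≤ n := by
      rw [Real.sqrt_le_left hn'.le]
      have : (1 : ℝ) ≤ n := by exact_mod_cast (by omega : 1 ≤ n)
      nlinarith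
    calc _ ≤ (n : ℝ) * n := mul_le_mul h9 h10 hs.le hn'.le
      _ ≤ 2 ^ n * 2 ^ n := mul_le_mul h8 h8 hn'.le (by positivity)
      _ = _ := by rw [two_mul, pow_add]
  set P : ℝ := 2 ^ ((1 + n) ^ (d + 2)) with hP
  have hP0 : 0 < P := by positivity
  set a : ℝ := 2 ^ (2 * (possibleSimplices n d).card) with ha
  have ha0 : 0 < a := by positivity
  rw [h4, ← one_div (Real.sqrt n), le_div_iff₀ hs]
  have h11 : a * (((d : ℝ) + 2) * Real.sqrt n) ≤ P :=
    (mul_le_mul_of_nonneg_left h7 ha0.le).trans h6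
  have h12 : a * (((d : ℝ) + 2) * (0.999 * P⁻¹)) * Real.sqrt n
      = 0.999 * (a * (((d : ℝ) + 2) * Real.sqrt n) / P) := by
    field_simp
  rw [h12]
  have h13 : a * (((d : ℝ) + 2) * Real.sqrt n) / P ≤ 1 := (div_le_one hP0).2 h11
  norm_num
  linarith

/-- The concentration term with the optimal parameter. -/
theorem concentration_term_le {n j : ℕ} {s : ℝ} (hj : 1 ≤ j) (hs : 9 ≤ s) (hsn : s ^ 2 = n) :
    ((j : ℝ) + 1) * j * ((2 * n + 1) * Real.log 2) / (3 / 2 * (j + 1 / 2) / s * n ^ 2)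
      + 3 / 5 * (3 / 2 * (j + 1 / 2) / s) ≤ 1.84 * (j + 1 / 2) / s := by
  have hj' : (1 : ℝ) ≤ j := by exact_mod_cast hj
  have hs0 : 0 < s := by linarith
  have hn : (81 : ℝ) ≤ n := by rw [← hsn]; nlinarith
  have hlog := Real.log_two_lt_d9
  have hlog0 : 0 < Real.log 2 := Real.log_pos one_lt_two
  -- With `c = x (j + 1/2) / s`, the two terms are at most `1.41 / x` and `0.6 x` times `(j + 1/2) /
  -- s`. The choice `x = 3/2`, close to the optimum, gives `0.94 + 0.9`.
  have h1 : ((j : ℝ) + 1) * j * ((2 * n + 1) * Real.log 2) / (3 / 2 * (j + 1 / 2) / s * n ^ 2)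
      ≤ 0.94 * (j + 1 / 2) / s := by
    rw [div_le_div_iff₀ (by positivity) hs0]
    have h2 : (2 * (n : ℝ) + 1) * Real.log 2 ≤ 1.41 * n := by nlinarith
    have h3 : ((j : ℝ) + 1) * j ≤ (j + 1 / 2) ^ 2 := by nlinarith
    have h4 : ((j : ℝ) + 1) * j * ((2 * n + 1) * Real.log 2) ≤ (j + 1 / 2) ^ 2 * (1.41 * n) :=
      mul_le_mul h3 h2 (by positivity) (by positivity)
    calc _ ≤ (j + 1 / 2) ^ 2 * (1.41 * n) * s := mul_le_mul_of_nonneg_right h4 hs0.le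
      _ = (j + 1 / 2) ^ 2 * (1.41 * n) * (s ^ 2) / s := by field_simp
      _ = 0.94 * (j + 1 / 2) * (3 / 2 * (j + 1 / 2) / s * n ^ 2) := by
        rw [hsn]; ring
  have h5 : 3 / 5 * (3 / 2 * ((j : ℝ) + 1 / 2) / s) = 0.9 * (j + 1 / 2) / s := by ring
  have h6 : 1.84 * ((j : ℝ) + 1 / 2) / s = 0.94 * (j + 1 / 2) / s + 0.9 * (j + 1 / 2) / s := by
    ring
  rw [h5, h6]
  exact add_le_add_left h1 _

/-- Both sides vanish at `m = 1`, so subtracting 1 from `√m` costs nothing there. The released `4 *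
d + 5` pays for the error terms that do not depend on `m`. -/
theorem sqrt_sub_one_le {m : ℕ} (hm : 1 ≤ m) (d : ℕ) :
    ((d : ℝ) + 1) * Real.sqrt (m - 1) ≤ (4 * d + 5) * (Real.sqrt m - 1) := by
  have hd : (0 : ℝ) ≤ d := Nat.cast_nonneg d
  rcases hm.eq_or_lt with h | h
  · subst h; simp
  have hm2 : (2 : ℝ) ≤ m := by exact_mod_cast h
  have hr2 : Real.sqrt m ^ 2 = m := Real.sq_sqrt (by linarith)
  have hr0 := Real.sqrt_nonneg (m : ℝ)
  have hr : (7 / 5 : ℝ) ≤ Real.sqrt m := Real.le_sqrt_of_sq_le (by linarith)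
  have hq : Real.sqrt (m - 1) ≤ 4 * (Real.sqrt m - 1) := by
    rw [Real.sqrt_le_left (by linarith)]
    nlinarith
  nlinarith [Real.sqrt_nonneg ((m : ℝ) - 1)]

/-- The summands are, in order, the type deviation and concentration errors for the two samples, the
tuples with repeated indices, and the transfer error. -/
theorem total_cost_le {m kU kW d n j : ℕ} (hm : 1 ≤ m) (hkU : kU ≤ m) (hkW : kW ≤ m)
    (hj : j ∈ Finset.Icc 1 d)
    (hlarge : Real.sqrt m * (4 * d + 5) + 4 < Real.sqrt n) :
    let c : ℝ := 3 / 2 * (j + 1 / 2) / Real.sqrt n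
    let b : ℝ := ((j : ℝ) + 1) * j * ((2 * n + 1) * Real.log 2) / (c * n ^ 2) + 3 / 5 * c
    ((j + 1) * (Real.sqrt ((kU - 1) / n) / 2) + b) + ((j + 1) * (Real.sqrt ((kW - 1) / n) / 2) + b)
      + (j + 1) * j / (2 * n) + (Real.sqrt n)⁻¹ ≤ (Real.sqrt m * (4 * d + 5) + 4) / Real.sqrt n := by
  intro c b
  obtain ⟨hj1, hjd⟩ := Finset.mem_Icc.1 hj
  have hjd' : (j : ℝ) ≤ d := by exact_mod_cast hjd
  have hj1' : (1 : ℝ) ≤ j := by exact_mod_cast hj1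
  have hm1 : (1 : ℝ) ≤ m := by exact_mod_cast hm
  have hr1 : 1 ≤ Real.sqrt m := Real.one_le_sqrt.2 hm1
  set s := Real.sqrt n with hs
  have hs9 : 4 * (d : ℝ) + 9 ≤ s := by nlinarith
  have hs0 : 0 < s := by linarith
  have hsn : s ^ 2 = n := Real.sq_sqrt (Nat.cast_nonneg n)
  have hb : b ≤ 1.84 * (j + 1 / 2) / s := concentration_term_le hj1 (by linarith) hsn
  have hk : ∀ k : ℕ, k ≤ m → Real.sqrt (((k : ℝ) - 1) / n) ≤ Real.sqrt (m - 1) / s := by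
    intro k hk
    rw [hs, ← Real.sqrt_div' _ (Nat.cast_nonneg n)]
    refine Real.sqrt_le_sqrt (div_le_div_of_nonneg_right ?_ (Nat.cast_nonneg n))
    have : (k : ℝ) ≤ m := by exact_mod_cast hk
    linarith
  have hdiag : ((j : ℝ) + 1) * j / (2 * n) ≤ (d + 1) / 8 / s := by
    rw [← hsn, div_div, div_le_div_iff₀ (by positivity) (by positivity)]
    have h1 : (j : ℝ) * 4 ≤ s := by linarith
    nlinarith [mul_nonneg (by positivity : (0 : ℝ) ≤ d + 1) hs0.le, mul_pos hs0 hs0,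
      mul_le_mul_of_nonneg_left h1 (by positivity : 0 ≤ ((j : ℝ) + 1) * s),
      mul_le_mul_of_nonneg_right hjd' (sq_nonneg s)]
  have hq := sqrt_sub_one_le hm d
  have hq0 := Real.sqrt_nonneg ((m : ℝ) - 1)
  set q := Real.sqrt ((m : ℝ) - 1)
  have hU := mul_le_mul_of_nonneg_left (hk kU hkU) (by positivity : 0 ≤ ((j : ℝ) + 1) / 2)
  have hW := mul_le_mul_of_nonneg_left (hk kW hkW) (by positivity : 0 ≤ ((j : ℝ) + 1) / 2)
  have hfin : ((j : ℝ) + 1) * q + 2 * (1.84 * (j + 1 / 2)) + (d + 1) / 8 + 1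
      ≤ Real.sqrt m * (4 * d + 5) + 4 := by
    have h1 := mul_le_mul_of_nonneg_right (by linarith : (j : ℝ) + 1 ≤ d + 1) hq0
    norm_num
    linarith
  calc _ ≤ ((j : ℝ) + 1) / 2 * (q / s) + ((j : ℝ) + 1) / 2 * (q / s)
        + 2 * (1.84 * (j + 1 / 2) / s) + (d + 1) / 8 / s + s⁻¹ := by linarith
    _ = (((j : ℝ) + 1) * q + 2 * (1.84 * (j + 1 / 2)) + (d + 1) / 8 + 1) / s := by
        field_simp
        ring
    _ ≤ _ := div_le_div_of_nonneg_right hfin hs0.le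

/-! ### Conclusion. -/

theorem mainTheorem8 (U W : Complexon) (m : ℕ) (hm : 1 ≤ m)
    (kU kW : ℕ) (hkU : kU ≤ m) (hkW : kW ≤ m)
    (PU : Fin kU → Set unitInterval) (PW : Fin kW → Set unitInterval)
    (hPU : IsEquipartition PU) (hPW : IsEquipartition PW)
    (hU : U.IsStepfunction PU) (hW : W.IsStepfunction PW)
    (d n : ℕ) (hd : 1 ≤ d) (hn : 2 ≤ n)
    (hF : ∀ F : AbstractSimplicialComplex (Fin n), IsOfDimension F d →
      |Complexon.homDensity F U - Complexon.homDensity F W|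
        ≤ 0.999 * ((2 : ℝ) ^ ((1 + n) ^ (d + 2)))⁻¹)
    (α : ℕ → ℝ) (hα : ∀ j, 0 ≤ α j) (hαd : ∀ j, d < j → α j = 0) :
    Complexon.cutDist α U.faceted W.faceted
      ≤ (Real.sqrt m * (4 * d + 5) + 4) / Real.sqrt n * ∑ j ∈ Finset.Icc 1 d, α j := by
  have hn0 : 0 < n := by omega
  have hn' : (0 : ℝ) < n := by exact_mod_cast hn0
  have hs0 : 0 < Real.sqrt n := Real.sqrt_pos.2 hn'
  -- For small `n` the coefficient on the right is at least 1 and the identity map suffices.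
  -- Otherwise `√n > 4 * d + 9`, which supplies all later size conditions.
  rcases le_or_gt (Real.sqrt n) (Real.sqrt m * (4 * d + 5) + 4) with hsmall | hlarge
  · have h1 : Complexon.cutDist α U.faceted W.faceted ≤ ∑ j ∈ Finset.Icc 1 d, α j * 1 :=
      cutDist_le (c := fun _ => 1) hα hαd (MeasurePreserving.id volume) fun j _ S =>
        abs_setIntegral_complexon_sub_le_one _ _ S
    simp only [mul_one] at h1
    exact h1.trans (le_mul_of_one_le_left (Finset.sum_nonneg fun j _ => hα j)
      ((one_le_div hs0).2 hsmall))
  have hm1 : (1 : ℝ) ≤ m := by exact_mod_cast hm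
  have hr1 : 1 ≤ Real.sqrt m := Real.one_le_sqrt.2 hm1
  have hd0 : (0 : ℝ) ≤ d := Nat.cast_nonneg d
  have hs9 : 4 * (d : ℝ) + 9 < Real.sqrt n := by nlinarith
  have hdn : d + 2 ≤ n := by
    have h1 : Real.sqrt n ^ 2 = n := Real.sq_sqrt hn'.le
    have : (d : ℝ) + 2 ≤ n := by rw [← h1]; nlinarith
    exact_mod_cast this
  choose zU hzU using hPU.nonempty_part
  choose zW hzW using hPW.nonempty_part
  set Sα := ∑ j ∈ Finset.Icc 1 d, α j with hSα
  have hSα0 : 0 ≤ Sα := Finset.sum_nonneg fun j _ => hα j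
  obtain ⟨u, w, F, hcost⟩ := exists_common_sample hPU hPW hU hW hzU hzW hF
    (sampleCost U.faceted zU α d) (sampleCost W.faceted zW α d)
    (fun w F => sampleCost_nonneg hα _ _ w F)
    (fun w F => sampleCost_le hα hn0 hPW.pos _ _ w F)
  have hcut := cutDist_le_sampleCost hn0 hPU hPW hU.faceted hW.faceted hzU hzW hα hαd u w F
  -- The exponential-moment parameter in dimension `j`, as in `concentration_term_le`; it is at most
  -- `2/5` because `√n > 4 * d + 9`.
  set c : ℕ → ℝ := fun j => 3 / 2 * (j + 1 / 2) / Real.sqrt n with hc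
  have hc0 : ∀ j ∈ Finset.Icc 1 d, 0 < c j := fun j _ => by simp only [hc]; positivity
  have hc1 : ∀ j ∈ Finset.Icc 1 d, c j ≤ 2 / 5 := by
    intro j hj
    have hjd : (j : ℝ) ≤ d := by exact_mod_cast (Finset.mem_Icc.1 hj).2
    simp only [hc]
    rw [div_le_iff₀ hs0]
    linarith
  have hEU := sampleExp_sampleCost_le hα hn0 hPU.pos U zU hc0 hc1
  have hEW := sampleExp_sampleCost_le hα hn0 hPW.pos W zW hc0 hc1
  have herr : (4 : ℝ) ^ (possibleSimplices n d).card * (((d : ℝ) + 2) * Sα *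
      (0.999 * ((2 : ℝ) ^ ((1 + n) ^ (d + 2)))⁻¹)) ≤ (Real.sqrt n)⁻¹ * Sα := by
    have := mul_le_mul_of_nonneg_right (transfer_error_le (by omega) hdn) hSα0
    refine le_trans (le_of_eq ?_) this
    ring
  refine hcut.trans ?_
  have htotal := Finset.sum_le_sum fun j hj => mul_le_mul_of_nonneg_left
    (total_cost_le (n := n) hm hkU hkW hj hlarge) (hα j)
  rw [← Finset.sum_mul, mul_comm Sα] at htotal
  refine le_trans ?_ htotal
  simp only [mul_add (α _), Finset.sum_add_distrib] at hEU hEW ⊢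
  rw [← Finset.sum_mul, mul_comm _ (Real.sqrt n)⁻¹]
  linarith
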